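/- Let chiralities be $p\in\{\leftarrow,\rightarrow,\downarrow,\uparrow\}$ and write $\mathbf C^4$-valued sequences on $\mathbf Z^2$ as $\psi=[\psi_\leftarrow,\psi_\rightarrow,\psi_\downarrow,\psi_\uparrow]^{\mathsf T}$. Let $S$ be the shift $(S\psi)(x)=[\psi_\leftarrow(x+e_1),\psi_\rightarrow(x-e_1),\psi_\downarrow(x+e_2),\psi_\uparrow(x-e_2)]^{\mathsf T}$, let $C$ be multiplication by unitary matrices $C(x)=(c_{k,l}(x))_{k,l=1}^4\in \mathrm U(4)$, and put $U=SC$, $U_0=S$, $V=U-U_0$. Assume that for some integer $n_0\ge 1$ we have $C(x)=I_4$ for $x\notin D=\{|x_1|\le n_0,\ |x_2|\le n_0\}$, and that $\det(c_{2k-1,2l-1}(x))_{k,l=1}^2\neq0$ and $\det(c_{2k,2l}(x))_{k,l=1}^2\ne0$ for every $x\in D$. Let $r_{-1}=0$, $r_j=2^j$ for $j\ge0$, $I_j=\{y\in\mathbf Z: r_{j-1}\le|y|<r_j\}$ and $$a_j(f)^2=\sum_{p\in\{\leftarrow,\rightarrow\}}\sum_{x_1\in I_j}\sum_{x_2\in\mathbf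 Z}|f_p(x)|^2+\sum_{p\in\{\downarrow,\uparrow\}}\sum_{x_2\in I_j}\sum_{x_1\in\mathbf Z}|f_p(x)|^2 .$$ Let $\mathcal B$ be the space of sequences with $\|f\|_{\mathcal B}=\sum_{j\ge0} r_j^{1/2}a_j(f)<\infty$, and let $\mathcal B^*$ be the space of sequences with $\|u\|_{\mathcal B^*}=\sup_{j\ge0} r_j^{-1/2}a_j(u)<\infty$, which is identified with the dual of $\mathcal B$ through the pairing $(u,f)=\sum_{x\in\mathbf Z^2}\langle u(x),f(x)\rangle$, where $\langle v,w\rangle=\sum_p v_p\overline{w_p}$. Let $\mathbf h(\theta)=\bigoplus_p\ell^2(\mathbf Z;\mathbf C)$ with its standard inner product (linear in the first variable). For $\theta\in[0,2\pi)$ define $\mathcal F^{(0)}(\theta)\in\mathbf B(\mathcal B;\mathbf h(\theta))$ by $$(\mathcal F^{(0)}_{\leftarrow}(\theta)f)(x_2)=\tfrac1{\sqrt{2\pi}}\sum_{y_1\in\mathbf Z}e^{-i\theta y_1}f_\leftarrow(y_1,x_2),\qquad (\mathcal F^{(0)}_{\rightarrow}(\theta)f)(x_2)=\tfrac1{\sqrt{2\pi}}\sum_{y_1\in\mathbf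 Z}e^{i\theta y_1}f_\rightarrow(y_1,x_2),$$ $$(\mathcal F^{(0)}_{\downarrow}(\theta)f)(x_1)=\tfrac1{\sqrt{2\pi}}\sum_{y_2\in\mathbf Z}e^{-i\theta y_2}f_\downarrow(x_1,y_2),\qquad (\mathcal F^{(0)}_{\uparrow}(\theta)f)(x_1)=\tfrac1{\sqrt{2\pi}}\sum_{y_2\in\mathbf Z}e^{i\theta y_2}f_\uparrow(x_1,y_2).$$ For $\kappa\in\mathbf C\setminus\mathbf R$ let $R(\kappa)=(U-e^{i\kappa})^{-1}$ on $\ell^2(\mathbf Z^2;\mathbf C^4)$. Then, for every $\theta\in[0,2\pi)$, the weak-$*$ limit $R(\theta+i0)=\lim_{\epsilon\downarrow0}R(\theta-i\log(1-\epsilon))$ exists in $\mathbf B(\mathcal B;\mathcal B^*)$, that is, there is $R(\theta+i0)\in\mathbf B(\mathcal B;\mathcal B^*)$ with $(R(\theta-i\log(1-\epsilon))f,g)\to(R(\theta+i0)f,g)$ for all $f,g\in\mathcal B$; and the distorted Fourier transformation $$\mathcal F^{(+)}(\theta)=\mathcal F^{(0)}(\theta)\,(1-V R(\theta+i0))\in\mathbf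 B(\mathcal B;\mathbf h(\theta))$$ with its adjoint $\mathcal F^{(+)}(\theta)^*\in\mathbf B(\mathbf h(\theta);\mathcal B^*)$, $(\mathcal F^{(+)}(\theta)^*\phi,f)=(\phi,\mathcal F^{(+)}(\theta)f)_{\mathbf h(\theta)}$, satisfies $$\mathcal F^{(+)}(\theta)\mathcal B=\mathbf h(\theta)\qquad\text{and}\qquad \{u\in\mathcal B^*:\ (U-e^{i\theta})u=0\}=\mathcal F^{(+)}(\theta)^*\,\mathbf h(\theta).$$ -/

import Mathlib

open scoped ENNReal

noncomputable section

namespace QuantumWalk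

/-! ### Sequences, shift and coin -/

/-- The four chiralities `←, →, ↓, ↑` of the walker on `ℤ²`. -/
inductive Chir : Type
  | left
  | right
  | down
  | up
  deriving DecidableEq

instance : Fintype Chir where
  elems := {.left, .right, .down, .up}
  complete p := by cases p <;> simp

/-- Pairs (position, chirality). -/
abbrev Idx : Type := (ℤ × ℤ) × Chir

/-- A `ℂ⁴`-valued sequence `ψ` on `ℤ²`; its component `ψ_p(x)` is `ψ (x, p)`. -/
abbrev Seq : Type := Idx → ℂ

/-- The step of the shift: `(S ψ)_p(x) = ψ_p(x + step p)`, so that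
`S ψ = [ψ_←(x + e₁), ψ_→(x - e₁), ψ_↓(x + e₂), ψ_↑(x - e₂)]`. -/
def Chir.step : Chir → ℤ × ℤ
  | .left => (1, 0)
  | .right => (-1, 0)
  | .down => (0, 1)
  | .up => (0, -1)

/-- The sign `+1` for `←, ↓` and `-1` for `→, ↑`. -/
def Chir.sign : Chir → ℤ
  | .left => 1
  | .right => -1
  | .down => 1
  | .up => -1

/-- The coordinate along which the chirality moves: `x₁` for `←, →` and `x₂` for `↓, ↑`. -/
def long : Idx → ℤ
  | (x, .left) => x.1
  | (x, .right) => x.1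
  | (x, .down) => x.2
  | (x, .up) => x.2

/-- The point of `ℤ²` whose coordinate along the direction of motion of `p` is `y` and whose
other coordinate is `z`: `(y, z)` for `←, →` and `(z, y)` for `↓, ↑`. -/
def site : Chir → ℤ → ℤ → ℤ × ℤ
  | .left, y, z => (y, z)
  | .right, y, z => (y, z)
  | .down, y, z => (z, y)
  | .up, y, z => (z, y)

/-- The shift operator `S` on all sequences. -/
def shift : Seq →ₗ[ℂ] Seq where
  toFun ψ i := ψ (i.1 + i.2.step, i.2)
  map_add' _ _ := rfl
  map_smul' _ _ := rfl

/-- A field of coin matrices satisfying the standing assumptions: `C(x) ∈ U(4)` for every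
`x ∈ ℤ²`; `C(x)` is the identity outside the square `D = {|x₁| ≤ n₀, |x₂| ≤ n₀}`; and, for
`x ∈ D`, the blocks of `C(x)` with rows and columns in `{←, ↓}` (first and third entries)
and in `{→, ↑}` (second and fourth entries) have non-zero determinant. -/
structure Coin where
  /-- the matrix `C(x)` -/
  mat : ℤ × ℤ → Matrix Chir Chir ℂ
  mem_unitary : ∀ x, mat x ∈ Matrix.unitaryGroup Chir ℂ
  /-- the size of the perturbed region -/
  n₀ : ℕ
  n₀_pos : 0 < n₀
  eq_one : ∀ x : ℤ × ℤ, ¬ (|x.1| ≤ n₀ ∧ |x.2| ≤ n₀) → mat x = 1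
  det_odd : ∀ x : ℤ × ℤ, |x.1| ≤ n₀ ∧ |x.2| ≤ n₀ →
    ((mat x).submatrix ![Chir.left, Chir.down] ![Chir.left, Chir.down]).det ≠ 0
  det_even : ∀ x : ℤ × ℤ, |x.1| ≤ n₀ ∧ |x.2| ≤ n₀ →
    ((mat x).submatrix ![Chir.right, Chir.up] ![Chir.right, Chir.up]).det ≠ 0

/-- The operator of multiplication by the coin on all sequences. -/
def Coin.mul (C : Coin) : Seq →ₗ[ℂ] Seq where
  toFun ψ i := ∑ q, C.mat i.1 i.2 q * ψ (i.1, q)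
  map_add' f g := by
    funext i; simp [mul_add, Finset.sum_add_distrib]
  map_smul' c f := by
    funext i; simp only [Pi.smul_apply, smul_eq_mul, RingHom.id_apply, Finset.mul_sum]
    exact Finset.sum_congr rfl fun q _ => by ring

/-- The time evolution operator `U = S C` on all sequences. -/
def evol (C : Coin) : Seq →ₗ[ℂ] Seq := shift ∘ₗ C.mul

/-- The perturbation `V = U - U₀`, where `U₀ = S`, on all sequences. -/
def pert (C : Coin) : Seq →ₗ[ℂ] Seq := evol C - shift

/-! ### `ℓ²`-sums in `[0, ∞]` -/

/-- The `ℓ²`-norm `(∑ |f i|²)^{1/2}` of a family in `[0, ∞]`. -/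
def l2 {ι : Type} (f : ι → ℝ≥0∞) : ℝ≥0∞ := (∑' i, f i ^ 2) ^ (1 / 2 : ℝ)

theorem l2_sq {ι : Type} (f : ι → ℝ≥0∞) : l2 f ^ 2 = ∑' i, f i ^ 2 := by
  rw [l2, ← ENNReal.rpow_natCast, ← ENNReal.rpow_mul]; norm_num

theorem l2_le_iff {ι : Type} {f : ι → ℝ≥0∞} {c : ℝ≥0∞} :
    l2 f ≤ c ↔ ∑' i, f i ^ 2 ≤ c ^ 2 := by
  rw [← l2_sq]
  exact (ENNReal.pow_le_pow_left_iff two_ne_zero).symm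

theorem l2_mono {ι : Type} {f g : ι → ℝ≥0∞} (h : ∀ i, f i ≤ g i) : l2 f ≤ l2 g := by
  rw [l2_le_iff, l2_sq]
  exact ENNReal.tsum_le_tsum fun i => pow_le_pow_left₀ zero_le (h i) 2

theorem le_l2 {ι : Type} (f : ι → ℝ≥0∞) (i : ι) : f i ≤ l2 f := by
  rw [← ENNReal.pow_le_pow_left_iff two_ne_zero, l2_sq]
  exact ENNReal.le_tsum i

theorem l2_const_mul {ι : Type} (c : ℝ≥0∞) (f : ι → ℝ≥0∞) :
    l2 (fun i => c * f i) = c * l2 f := by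
  rw [← (ENNReal.pow_right_strictMono two_ne_zero).injective.eq_iff (f := fun x : ℝ≥0∞ => x ^ 2)]
  simp only [mul_pow, l2_sq, ENNReal.tsum_mul_left]

theorem l2_finset_add_le {ι : Type} (s : Finset ι) (f g : ι → ℝ≥0∞) :
    ∑ i ∈ s, (f i + g i) ^ 2 ≤
      ((∑ i ∈ s, f i ^ 2) ^ (1 / 2 : ℝ) + (∑ i ∈ s, g i ^ 2) ^ (1 / 2 : ℝ)) ^ 2 := by
  have h := ENNReal.Lp_add_le s f g (p := 2) one_le_two
  have h2 := pow_le_pow_left₀ zero_le h 2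
  refine le_trans (le_of_eq ?_) (h2.trans (le_of_eq ?_))
  · rw [← ENNReal.rpow_natCast (n := 2), ← ENNReal.rpow_mul]
    norm_num
  · norm_num

theorem l2_add_le {ι : Type} (f g : ι → ℝ≥0∞) :
    l2 (fun i => f i + g i) ≤ l2 f + l2 g := by
  rw [l2_le_iff]
  rw [ENNReal.tsum_eq_iSup_sum]
  refine iSup_le fun s => (l2_finset_add_le s f g).trans ?_
  unfold l2
  gcongr <;> exact ENNReal.sum_le_tsum s

theorem l2_zero {ι : Type} : l2 (fun _ : ι => (0 : ℝ≥0∞)) = 0 := by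
  simp [l2]

theorem l2_sum_le {ι κ : Type} (s : Finset κ) (f : κ → ι → ℝ≥0∞) :
    l2 (fun i => ∑ j ∈ s, f j i) ≤ ∑ j ∈ s, l2 (f j) := by
  classical
  induction s using Finset.induction_on with
  | empty => simp [l2_zero]
  | insert a s ha ih =>
    simp only [Finset.sum_insert ha]
    exact (l2_add_le _ _).trans (by gcongr)

/-- Minkowski's inequality for countable sums. -/
theorem l2_tsum_le {ι κ : Type} (f : κ → ι → ℝ≥0∞) :
    l2 (fun i => ∑' j, f j i) ≤ ∑' j, l2 (f j) := by
  rw [l2_le_iff]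
  rw [ENNReal.tsum_eq_iSup_sum]
  refine iSup_le fun t => ?_
  have hlim : Filter.Tendsto (fun s : Finset κ => ∑ i ∈ t, (∑ j ∈ s, f j i) ^ 2) Filter.atTop
      (nhds (∑ i ∈ t, (∑' j, f j i) ^ 2)) :=
    tendsto_finsetSum _ fun i _ => ENNReal.Tendsto.pow ENNReal.summable.hasSum
  refine le_of_tendsto' hlim fun s => ?_
  calc ∑ i ∈ t, (∑ j ∈ s, f j i) ^ 2 ≤ l2 (fun i => ∑ j ∈ s, f j i) ^ 2 := by
        rw [l2_sq]; exact ENNReal.sum_le_tsum t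
    _ ≤ (∑' j, l2 (f j)) ^ 2 := by
        gcongr
        exact (l2_sum_le s f).trans (ENNReal.sum_le_tsum s)

/-! ### The space `ℓ² = ℓ²(ℤ²; ℂ⁴)` -/

/-- The Hilbert space `ℓ²(ℤ²; ℂ⁴)`. -/
abbrev L2 : Type := lp (fun _ : Idx => ℂ) 2

theorem memℓp_iff_l2 {ι : Type} (f : ι → ℂ) :
    Memℓp f 2 ↔ l2 (fun i => ‖f i‖ₑ) ≠ ∞ := by
  rw [memℓp_gen_iff (by norm_num), l2]
  have h : ∀ i, ‖f i‖ₑ ^ 2 = ENNReal.ofReal (‖f i‖ ^ (2 : ℝ≥0∞).toReal) := fun i => by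
    rw [← ofReal_norm, ← ENNReal.ofReal_pow (norm_nonneg _)]; norm_num
  simp_rw [h]
  rw [Ne, ENNReal.rpow_eq_top_iff_of_pos (by norm_num)]
  constructor
  · intro hs; exact hs.tsum_ofReal_ne_top
  · intro hs
    have := ENNReal.summable_toReal hs
    refine this.congr fun i => ?_
    rw [ENNReal.toReal_ofReal (by positivity)]

theorem enorm_lp {ι : Type} (f : lp (fun _ : ι => ℂ) 2) : ‖f‖ₑ = l2 (fun i => ‖f i‖ₑ) := by
  have h0 := lp.norm_rpow_eq_tsum (p := 2) (by norm_num) f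
  have hs := (memℓp_gen_iff (p := 2) (by norm_num)).1 (lp.memℓp f)
  rw [← (ENNReal.pow_right_strictMono two_ne_zero).injective.eq_iff (f := fun x : ℝ≥0∞ => x ^ 2)]
  simp only [l2_sq]
  have h : ∀ i, ‖f i‖ₑ ^ 2 = ENNReal.ofReal (‖f i‖ ^ (2 : ℝ≥0∞).toReal) := fun i => by
    rw [← ofReal_norm, ← ENNReal.ofReal_pow (norm_nonneg _)]; norm_num
  simp_rw [h]
  rw [← ENNReal.ofReal_tsum_of_nonneg (fun i => by positivity) hs, ← h0,
    ← ofReal_norm, ← ENNReal.ofReal_pow (norm_nonneg _)]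
  norm_num

theorem tsum_evol (C : Coin) (ψ : Seq) : ∑' i, ‖evol C ψ i‖ₑ ^ 2 = ∑' i, ‖ψ i‖ₑ ^ 2 := by
  have h1 : ∑' i, ‖evol C ψ i‖ₑ ^ 2 = ∑' i, ‖C.mul ψ i‖ₑ ^ 2 := by
    rw [ENNReal.tsum_prod' (α := ℤ × ℤ), ENNReal.tsum_prod' (α := ℤ × ℤ),
      ENNReal.tsum_comm (α := ℤ × ℤ), ENNReal.tsum_comm (α := ℤ × ℤ)]
    refine tsum_congr fun p => ?_
    exact (Equiv.addRight p.step).tsum_eq (fun x => ‖C.mul ψ (x, p)‖ₑ ^ 2)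
  rw [h1, ENNReal.tsum_prod' (α := ℤ × ℤ), ENNReal.tsum_prod' (α := ℤ × ℤ)]
  refine tsum_congr fun x => ?_
  simp only [tsum_fintype]
  have hC := C.mem_unitary x
  have key : ∑ p, ‖C.mul ψ (x, p)‖ ^ 2 = ∑ p, ‖ψ (x, p)‖ ^ 2 := by
    let v : Chir → ℂ := fun p => ψ (x, p)
    have e1 : ∀ w : Chir → ℂ, ((∑ p, ‖w p‖ ^ 2 : ℝ) : ℂ) = dotProduct (star w) w := fun w => by
      simp only [dotProduct, Complex.ofReal_sum, Pi.star_apply]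
      refine Finset.sum_congr rfl fun p _ => ?_
      rw [RCLike.star_def, ← Complex.normSq_eq_conj_mul_self, Complex.normSq_eq_norm_sq]
    have e2 : (fun p => C.mul ψ (x, p)) = (C.mat x).mulVec v := rfl
    have e3 := e1 (fun p => C.mul ψ (x, p))
    rw [e2, Matrix.star_mulVec, ← Matrix.dotProduct_mulVec, Matrix.mulVec_mulVec,
      ← Matrix.star_eq_conjTranspose, (Matrix.mem_unitaryGroup_iff').1 hC, Matrix.one_mulVec,
      ← e1] at e3
    exact_mod_cast e3
  have h : ∀ f : Chir → ℂ, ∑ p, ‖f p‖ₑ ^ 2 = ENNReal.ofReal (∑ p, ‖f p‖ ^ 2) := fun f => by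
    rw [ENNReal.ofReal_sum_of_nonneg fun _ _ => by positivity]
    refine Finset.sum_congr rfl fun p _ => ?_
    rw [← ofReal_norm, ← ENNReal.ofReal_pow (norm_nonneg _)]
  rw [h (fun p => C.mul ψ (x, p)), h (fun p => ψ (x, p)), key]

theorem l2_evol (C : Coin) (ψ : Seq) : l2 (fun i => ‖evol C ψ i‖ₑ) = l2 (fun i => ‖ψ i‖ₑ) := by
  unfold l2; rw [tsum_evol]

/-- The time evolution operator `U = S C` on `ℓ²`. -/
def evolL2 (C : Coin) : L2 →L[ℂ] L2 :=
  LinearMap.mkContinuous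
    { toFun := fun ψ => (⟨evol C ψ, (memℓp_iff_l2 _).2 (by
        rw [l2_evol]; exact (memℓp_iff_l2 _).1 (lp.memℓp ψ))⟩ : L2)
      map_add' := fun f g => Subtype.ext (map_add (evol C) (f : Seq) g)
      map_smul' := fun c f => Subtype.ext (map_smul (evol C) c (f : Seq)) } 1 (fun ψ => by
    have : ‖(⟨evol C ψ, (memℓp_iff_l2 _).2 (by
        rw [l2_evol]; exact (memℓp_iff_l2 _).1 (lp.memℓp ψ))⟩ : L2)‖ₑ = ‖ψ‖ₑ := by
      rw [enorm_lp, enorm_lp]; exact l2_evol C ψ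
    rw [one_mul]
    exact le_of_eq (by simpa [enorm_eq_iff_norm_eq] using this))

/-- The resolvent `R(κ) = (U - e^{iκ})⁻¹` on `ℓ²` for `κ ∈ ℂ \ ℝ`. -/
def resolventL2 (C : Coin) (κ : ℂ) : L2 →L[ℂ] L2 :=
  Ring.inverse (evolL2 C - Complex.exp (Complex.I * κ) • (1 : L2 →L[ℂ] L2))

/-! ### The anisotropic Agmon–Hörmander spaces -/

/-- The inner radius `r_{j-1}` of the `j`-th shell: `r_{-1} = 0` and `r_j = 2^j`. -/
def innerRadius : ℕ → ℕ
  | 0 => 0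
  | j + 1 => 2 ^ j

/-- The `j`-th anisotropic shell: all `(x, p)` with `x₁ ∈ I_j` if `p ∈ {←, →}` and
`x₂ ∈ I_j` if `p ∈ {↓, ↑}`, where `I_j = {y ∈ ℤ : r_{j-1} ≤ |y| < r_j}`. -/
def shell (j : ℕ) : Set Idx :=
  {i | innerRadius j ≤ (long i).natAbs ∧ (long i).natAbs < 2 ^ j}

/-- The shell sums `a_j(f)`, as elements of `[0, ∞]`. -/
def shellNorm (j : ℕ) (f : Seq) : ℝ≥0∞ := l2 (fun i : shell j => ‖f i‖ₑ)

/-- The weight `r_j^{1/2}`. -/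
def wt (j : ℕ) : ℝ≥0∞ := (2 ^ j) ^ (1 / 2 : ℝ)

/-- `‖f‖_𝓑 = ∑_j r_j^{1/2} a_j(f)` in `[0, ∞]`. -/
def normB (f : Seq) : ℝ≥0∞ := ∑' j, wt j * shellNorm j f

/-- `‖u‖_{𝓑*} = sup_j r_j^{-1/2} a_j(u)` in `[0, ∞]`. -/
def normBs (u : Seq) : ℝ≥0∞ := ⨆ j, (wt j)⁻¹ * shellNorm j u

theorem wt_ne_zero (j : ℕ) : wt j ≠ 0 := by
  simp [wt]

theorem wt_ne_top (j : ℕ) : wt j ≠ ∞ := by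
  simp [wt]

theorem innerRadius_le_iff (j n : ℕ) : (innerRadius j ≤ n ∧ n < 2 ^ j) ↔ n.size = j := by
  rw [← Nat.size_le]
  cases j with
  | zero => simp [innerRadius]
  | succ k => simp only [innerRadius, ← Nat.lt_size]; omega

theorem mem_shell_iff (j : ℕ) (i : Idx) : i ∈ shell j ↔ (long i).natAbs.size = j :=
  innerRadius_le_iff j _

theorem shellNorm_add_le (j : ℕ) (f g : Seq) : shellNorm j (f + g) ≤ shellNorm j f + shellNorm j g :=
  (l2_mono fun _ => enorm_add_le _ _).trans (l2_add_le _ _)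

theorem shellNorm_smul (j : ℕ) (c : ℂ) (f : Seq) : shellNorm j (c • f) = ‖c‖ₑ * shellNorm j f := by
  simp only [shellNorm, ← l2_const_mul, Pi.smul_apply, smul_eq_mul, enorm_mul]

theorem shellNorm_zero (j : ℕ) : shellNorm j 0 = 0 := by
  simp [shellNorm, l2]

theorem normB_add_le (f g : Seq) : normB (f + g) ≤ normB f + normB g := by
  unfold normB
  rw [← ENNReal.tsum_add]
  exact ENNReal.tsum_le_tsum fun j => by
    rw [← mul_add]; gcongr; exact shellNorm_add_le j f g

theorem normB_smul (c : ℂ) (f : Seq) : normB (c • f) = ‖c‖ₑ * normB f := by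
  unfold normB
  rw [← ENNReal.tsum_mul_left]
  exact tsum_congr fun j => by rw [shellNorm_smul]; ring

theorem normB_zero : normB 0 = 0 := by simp [normB, shellNorm_zero]

theorem normBs_add_le (f g : Seq) : normBs (f + g) ≤ normBs f + normBs g := by
  refine iSup_le fun j => ?_
  calc (wt j)⁻¹ * shellNorm j (f + g) ≤ (wt j)⁻¹ * shellNorm j f + (wt j)⁻¹ * shellNorm j g := by
        rw [← mul_add]; gcongr; exact shellNorm_add_le j f g
    _ ≤ normBs f + normBs g :=
        add_le_add (le_iSup (fun j => (wt j)⁻¹ * shellNorm j f) j) (le_iSup (fun j => (wt j)⁻¹ * shellNorm j g) j)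

theorem normBs_smul (c : ℂ) (f : Seq) : normBs (c • f) = ‖c‖ₑ * normBs f := by
  unfold normBs
  rw [ENNReal.mul_iSup]
  exact iSup_congr fun j => by rw [shellNorm_smul]; ring

theorem normBs_zero : normBs 0 = 0 := by simp [normBs, shellNorm_zero]

theorem enorm_le_shellNorm (f : Seq) (i : Idx) : ‖f i‖ₑ ≤ shellNorm (long i).natAbs.size f :=
  le_l2 (fun k : shell (long i).natAbs.size => ‖f k‖ₑ) ⟨i, (mem_shell_iff _ _).2 rfl⟩

theorem enorm_le_normBs (f : Seq) (i : Idx) :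
    ‖f i‖ₑ ≤ wt (long i).natAbs.size * normBs f := by
  refine (enorm_le_shellNorm f i).trans ?_
  rw [mul_comm, ← ENNReal.div_le_iff (wt_ne_zero _) (wt_ne_top _), ENNReal.div_eq_inv_mul]
  exact le_iSup (fun j => (wt j)⁻¹ * shellNorm j f) _

theorem one_le_wt (j : ℕ) : 1 ≤ wt j :=
  ENNReal.one_le_rpow (one_le_pow₀ one_le_two) (by norm_num)

theorem shellNorm_le_normB (f : Seq) (j : ℕ) : shellNorm j f ≤ normB f :=
  calc shellNorm j f ≤ wt j * shellNorm j f := le_mul_of_one_le_left' (one_le_wt j)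
    _ ≤ normB f := ENNReal.le_tsum j

theorem enorm_le_normB (f : Seq) (i : Idx) : ‖f i‖ₑ ≤ normB f :=
  (enorm_le_shellNorm f i).trans (shellNorm_le_normB f _)

/-- The space `𝓑` as a subspace of the space of all sequences. -/
def subB : Submodule ℂ Seq where
  carrier := {f | normB f < ∞}
  add_mem' hf hg := (normB_add_le _ _).trans_lt (ENNReal.add_lt_top.2 ⟨hf, hg⟩)
  zero_mem' := by simp [normB_zero]
  smul_mem' c f hf := by
    simp only [Set.mem_ofPred_eq, normB_smul]; exact ENNReal.mul_lt_top (by simp) hf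

/-- The space `𝓑*` as a subspace of the space of all sequences. -/
def subBs : Submodule ℂ Seq where
  carrier := {f | normBs f < ∞}
  add_mem' hf hg := (normBs_add_le _ _).trans_lt (ENNReal.add_lt_top.2 ⟨hf, hg⟩)
  zero_mem' := by simp [normBs_zero]
  smul_mem' c f hf := by
    simp only [Set.mem_ofPred_eq, normBs_smul]; exact ENNReal.mul_lt_top (by simp) hf

/-- The normed space `𝓑` of all sequences with `‖f‖_𝓑 < ∞`. -/
def SpaceB : Type := subB

/-- The normed space `𝓑*` of all sequences with `‖u‖_{𝓑*} < ∞`. -/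
def SpaceBs : Type := subBs

instance : AddCommGroup SpaceB := inferInstanceAs (AddCommGroup subB)
instance : Module ℂ SpaceB := inferInstanceAs (Module ℂ subB)
instance : AddCommGroup SpaceBs := inferInstanceAs (AddCommGroup subBs)
instance : Module ℂ SpaceBs := inferInstanceAs (Module ℂ subBs)

/-- The sequence underlying an element of `𝓑`. -/
def SpaceB.seq : SpaceB →ₗ[ℂ] Seq := subB.subtype

/-- The sequence underlying an element of `𝓑*`. -/
def SpaceBs.seq : SpaceBs →ₗ[ℂ] Seq := subBs.subtype

/-- The element of `𝓑` given by a sequence of finite norm. -/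
def SpaceB.mk (f : Seq) (hf : normB f < ∞) : SpaceB := (⟨f, hf⟩ : subB)

/-- The element of `𝓑*` given by a sequence of finite norm. -/
def SpaceBs.mk (f : Seq) (hf : normBs f < ∞) : SpaceBs := (⟨f, hf⟩ : subBs)

theorem SpaceB.seq_mk (f : Seq) (hf : normB f < ∞) : (SpaceB.mk f hf).seq = f := rfl
theorem SpaceBs.seq_mk (f : Seq) (hf : normBs f < ∞) : (SpaceBs.mk f hf).seq = f := rfl
theorem SpaceB.lt_top (f : SpaceB) : normB f.seq < ∞ := f.2
theorem SpaceBs.lt_top (f : SpaceBs) : normBs f.seq < ∞ := f.2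
theorem SpaceB.ext {f g : SpaceB} (h : f.seq = g.seq) : f = g := Subtype.ext h
theorem SpaceBs.ext {f g : SpaceBs} (h : f.seq = g.seq) : f = g := Subtype.ext h

instance : Norm SpaceB := ⟨fun f => (normB f.seq).toReal⟩
instance : Norm SpaceBs := ⟨fun f => (normBs f.seq).toReal⟩

theorem SpaceB.core : NormedSpace.Core ℂ SpaceB where
  norm_nonneg _ := ENNReal.toReal_nonneg
  norm_smul c f := by
    change (normB (SpaceB.seq (c • f))).toReal = _ * (normB f.seq).toReal
    rw [map_smul, normB_smul, ENNReal.toReal_mul, toReal_enorm]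
  norm_triangle f g := by
    change (normB (SpaceB.seq (f + g))).toReal ≤ (normB f.seq).toReal + (normB g.seq).toReal
    rw [map_add, ← ENNReal.toReal_add f.lt_top.ne g.lt_top.ne]
    exact ENNReal.toReal_mono (ENNReal.add_lt_top.2 ⟨f.lt_top, g.lt_top⟩).ne (normB_add_le _ _)
  norm_eq_zero_iff f := by
    change (normB f.seq).toReal = 0 ↔ _
    rw [ENNReal.toReal_eq_zero_iff, or_iff_left f.lt_top.ne]
    constructor
    · intro h
      refine SpaceB.ext (funext fun i => ?_)
      have := enorm_le_normB f.seq i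
      rw [h] at this
      simpa using this
    · rintro rfl
      rw [map_zero, normB_zero]

theorem SpaceBs.core : NormedSpace.Core ℂ SpaceBs where
  norm_nonneg _ := ENNReal.toReal_nonneg
  norm_smul c f := by
    change (normBs (SpaceBs.seq (c • f))).toReal = _ * (normBs f.seq).toReal
    rw [map_smul, normBs_smul, ENNReal.toReal_mul, toReal_enorm]
  norm_triangle f g := by
    change (normBs (SpaceBs.seq (f + g))).toReal ≤ (normBs f.seq).toReal + (normBs g.seq).toReal
    rw [map_add, ← ENNReal.toReal_add f.lt_top.ne g.lt_top.ne]
    exact ENNReal.toReal_mono (ENNReal.add_lt_top.2 ⟨f.lt_top, g.lt_top⟩).ne (normBs_add_le _ _)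
  norm_eq_zero_iff f := by
    change (normBs f.seq).toReal = 0 ↔ _
    rw [ENNReal.toReal_eq_zero_iff, or_iff_left f.lt_top.ne]
    constructor
    · intro h
      refine SpaceBs.ext (funext fun i => ?_)
      have := enorm_le_normBs f.seq i
      rw [h, mul_zero] at this
      simpa using this
    · rintro rfl
      rw [map_zero, normBs_zero]

instance : NormedAddCommGroup SpaceB := NormedAddCommGroup.ofCore SpaceB.core
instance : NormedSpace ℂ SpaceB := NormedSpace.ofCore SpaceB.core
instance : NormedAddCommGroup SpaceBs := NormedAddCommGroup.ofCore SpaceBs.core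
instance : NormedSpace ℂ SpaceBs := NormedSpace.ofCore SpaceBs.core

theorem SpaceB.enorm_eq (f : SpaceB) : ‖f‖ₑ = normB f.seq := by
  rw [← ofReal_norm]; exact ENNReal.ofReal_toReal f.lt_top.ne

theorem SpaceBs.enorm_eq (f : SpaceBs) : ‖f‖ₑ = normBs f.seq := by
  rw [← ofReal_norm]; exact ENNReal.ofReal_toReal f.lt_top.ne

/-- `𝓑 ⊆ ℓ²`. -/
theorem memℓp_of_normB_lt_top (f : SpaceB) : Memℓp f.seq 2 := by
  rw [memℓp_iff_l2]
  refine ((?_ : _ ≤ normB f.seq).trans_lt f.lt_top).ne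
  have h : ∀ i, ‖f.seq i‖ₑ ≤ ∑' j, (shell j).indicator (fun i => ‖f.seq i‖ₑ) i := fun i => by
    refine le_trans (le_of_eq ?_) (ENNReal.le_tsum (long i).natAbs.size)
    rw [Set.indicator_of_mem ((mem_shell_iff _ _).2 rfl)]
  refine (l2_mono h).trans ((l2_tsum_le _).trans (ENNReal.tsum_le_tsum fun j => ?_))
  calc l2 ((shell j).indicator fun i => ‖f.seq i‖ₑ) = shellNorm j f.seq := by
        unfold shellNorm l2
        rw [tsum_subtype (shell j) (fun i => ‖f.seq i‖ₑ ^ 2)]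
        congr 1
        refine tsum_congr fun i => ?_
        by_cases hi : i ∈ shell j <;> simp [hi]
    _ ≤ wt j * shellNorm j f.seq := le_mul_of_one_le_left' (one_le_wt j)

/-- An element of `𝓑` as an element of `ℓ²`. -/
def SpaceB.toL2 (f : SpaceB) : L2 := ⟨f.seq, memℓp_of_normB_lt_top f⟩

/-- The pairing `(u, f) = ∑_x ⟨u(x), f(x)⟩` of sequences, conjugate linear in `f`. -/
def pairing (u f : Seq) : ℂ := ∑' i, u i * (starRingEnd ℂ) (f i)

theorem shellNorm_of_not_mem (j : ℕ) (f : Seq) (h : ∀ i ∈ shell j, f i = 0) : shellNorm j f = 0 := by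
  unfold shellNorm l2
  simp [fun i : shell j => h i i.2]

/-- A sequence supported in one shell has norm `r_j^{1/2} a_j(f)` in `𝓑`. -/
theorem normB_of_shell (j : ℕ) (f : Seq) (h : ∀ i, i ∉ shell j → f i = 0) :
    normB f = wt j * shellNorm j f := by
  unfold normB
  rw [tsum_eq_single j]
  intro k hk
  rw [shellNorm_of_not_mem k f, mul_zero]
  intro i hi
  refine h i fun hj => hk ?_
  rw [mem_shell_iff] at hi hj
  exact hi.symm.trans hj

theorem shellNorm_le_l2 (j : ℕ) (f : Seq) : shellNorm j f ≤ l2 (fun i => ‖f i‖ₑ) := by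
  rw [shellNorm, l2_le_iff, l2_sq]
  exact ENNReal.tsum_comp_le_tsum_of_injective Subtype.val_injective fun i => ‖f i‖ₑ ^ 2

theorem normB_single_lt_top (i : Idx) : normB (Pi.single i 1) < ∞ := by
  rw [normB_of_shell (long i).natAbs.size]
  · refine ENNReal.mul_lt_top (wt_ne_top _).lt_top ((shellNorm_le_l2 _ _).trans_lt ?_)
    have : l2 (fun k => ‖(Pi.single i 1 : Seq) k‖ₑ) ≤ 1 := by
      rw [l2_le_iff, tsum_eq_single i]
      · simp
      · intro k hk; simp [hk]
    exact this.trans_lt ENNReal.one_lt_top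
  · intro k hk
    rw [Pi.single_eq_of_ne]
    rintro rfl
    exact hk ((mem_shell_iff _ _).2 rfl)

/-- The sequence which is `1` at `i = (x, p)` and `0` elsewhere. -/
def delta (i : Idx) : SpaceB := SpaceB.mk (Pi.single i 1) (normB_single_lt_top i)

/-- Evaluation at `i = (x, p)` on `𝓑*`. -/
def SpaceBs.eval (i : Idx) : SpaceBs →L[ℂ] ℂ :=
  LinearMap.mkContinuous (LinearMap.proj i ∘ₗ SpaceBs.seq) (wt (long i).natAbs.size).toReal
    fun u => by
      have h := enorm_le_normBs u.seq i
      have h' := ENNReal.toReal_mono (ENNReal.mul_ne_top (wt_ne_top _) u.lt_top.ne) h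
      rwa [ENNReal.toReal_mul, toReal_enorm] at h'

/-! ### The perturbation as an operator from `𝓑*` to `𝓑` -/

/-- A finite set of pairs (position, chirality) supporting all sequences `V u`. -/
theorem pert_support (C : Coin) : ∃ s : Finset Idx, ∀ (u : Seq), ∀ i ∉ s, pert C u i = 0 := by
  classical
  refine ⟨((Finset.Icc (-(C.n₀ : ℤ)) C.n₀ ×ˢ Finset.Icc (-(C.n₀ : ℤ)) C.n₀) ×ˢ
    (Finset.univ : Finset Chir)).image fun i : Idx => (i.1 - i.2.step, i.2), fun u i hi => ?_⟩
  have h : C.mat (i.1 + i.2.step) = 1 := by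
    refine C.eq_one _ fun hx => hi (Finset.mem_image.2 ⟨(i.1 + i.2.step, i.2), ?_, ?_⟩)
    · simp only [Finset.mem_product, Finset.mem_Icc, Finset.mem_univ, and_true]
      exact ⟨abs_le.1 hx.1, abs_le.1 hx.2⟩
    · simp
  change (∑ q, C.mat (i.1 + i.2.step) i.2 q * u (i.1 + i.2.step, q)) - u (i.1 + i.2.step, i.2) = 0
  rw [h]
  simp [Matrix.one_apply]

theorem eq_sum_delta (s : Finset Idx) (f : Seq) (h : ∀ i ∉ s, f i = 0) :
    SpaceB.seq (∑ i ∈ s, f i • delta i) = f := by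
  classical
  funext k
  rw [map_sum, Finset.sum_apply]
  have : ∀ i ∈ s, (SpaceB.seq (f i • delta i)) k = if k = i then f i else 0 := fun i _ => by
    change f i • (Pi.single i 1 : Seq) k = _
    rw [Pi.single_apply]; split_ifs <;> simp
  rw [Finset.sum_congr rfl this, Finset.sum_ite_eq]
  split_ifs with hk
  · rfl
  · exact (h k hk).symm

theorem normB_pert_lt_top (C : Coin) (u : Seq) : normB (pert C u) < ∞ := by
  obtain ⟨s, hs⟩ := pert_support C
  rw [← eq_sum_delta s (pert C u) (hs u)]
  exact SpaceB.lt_top _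

/-- The perturbation `V = U - U₀` as a bounded operator from `𝓑*` to `𝓑`. -/
def pertBsB (C : Coin) : SpaceBs →L[ℂ] SpaceB where
  toFun u := SpaceB.mk (pert C u.seq) (normB_pert_lt_top C u.seq)
  map_add' u v := SpaceB.ext (by simp [SpaceB.seq_mk])
  map_smul' c u := SpaceB.ext (by simp [SpaceB.seq_mk])
  cont := by
    obtain ⟨s, hs⟩ := pert_support C
    have h : (fun u : SpaceBs => SpaceB.mk (pert C u.seq) (normB_pert_lt_top C u.seq)) =
        fun u => ∑ i ∈ s, (pert C u.seq i) • delta i := by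
      funext u
      refine SpaceB.ext ?_
      rw [eq_sum_delta s _ (hs u.seq), SpaceB.seq_mk]
    change Continuous (fun u : SpaceBs => SpaceB.mk (pert C u.seq) (normB_pert_lt_top C u.seq))
    rw [h]
    refine continuous_finsetSum _ fun i _ => Continuous.fun_smul ?_ continuous_const
    have h2 : (fun u : SpaceBs => pert C u.seq i) = fun u =>
        (∑ q, C.mat (i.1 + i.2.step) i.2 q * SpaceBs.eval (i.1 + i.2.step, q) u) -
          SpaceBs.eval (i.1 + i.2.step, i.2) u := rfl
    rw [h2]
    fun_prop

/-! ### The boundary value of the resolvent -/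

/-- `R` is the limit `R(θ + i0) = lim_{ε ↓ 0} R(θ - i log(1 - ε))` in the weak-* topology. -/
def IsBoundaryResolvent (C : Coin) (θ : ℝ) (R : SpaceB →L[ℂ] SpaceBs) : Prop :=
  ∀ f g : SpaceB, Filter.Tendsto
    (fun ε : ℝ => pairing
      (resolventL2 C ((θ : ℂ) - Complex.I * (Real.log (1 - ε) : ℝ)) f.toL2) g.seq)
    (nhdsWithin 0 (Set.Ioi 0)) (nhds (pairing (R f).seq g.seq))

open Classical in
/-- The bounded operator `R(θ + i0) : 𝓑 → 𝓑*`. -/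
def boundaryResolvent (C : Coin) (θ : ℝ) : SpaceB →L[ℂ] SpaceBs :=
  if h : ∃ R, IsBoundaryResolvent C θ R then h.choose else 0

/-! ### The Fourier transformations -/

/-- The Hilbert space `h(θ) = ⨁_p ℓ²(ℤ; ℂ)`; the component `φ_p(z)` of `φ` is `φ (p, z)`. -/
abbrev SpaceH : Type := lp (fun _ : Chir × ℤ => ℂ) 2

/-- The sequence `(2π)^{-1/2} ∑_y e^{∓iθy} f_p(y, z)` (with `f_p(z, y)` for `p ∈ {↓, ↑}`), the
sign being `-` for `p ∈ {←, ↓}` and `+` for `p ∈ {→, ↑}`. -/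
def fourier0Seq (θ : ℝ) (f : Seq) : Chir × ℤ → ℂ := fun k =>
  ((1 / Real.sqrt (2 * Real.pi) : ℝ) : ℂ) *
    ∑' y : ℤ, Complex.exp (-(Complex.I * θ * (k.1.sign * y : ℤ))) * f (site k.1 y k.2, k.1)

theorem long_site (p : Chir) (y z : ℤ) : long (site p y z, p) = y := by cases p <;> rfl

theorem site_injective : Function.Injective
    (fun k : (Chir × ℤ) × ℤ => ((site k.1.1 k.2 k.1.2, k.1.1) : Idx)) := by
  rintro ⟨⟨p, z⟩, y⟩ ⟨⟨p', z'⟩, y'⟩ h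
  simp only [Prod.mk.injEq] at h
  obtain ⟨h1, rfl⟩ := h
  cases p <;> simp only [site, Prod.mk.injEq] at h1 <;> simp [h1]

theorem sqrt_sq (x : ℝ≥0∞) : (x ^ (1 / 2 : ℝ)) ^ 2 = x := by
  rw [← ENNReal.rpow_natCast, ← ENNReal.rpow_mul]; norm_num

/-- The sums `∑_y |f_p(y, z)|` are square summable in `(p, z)`. -/
theorem l2_line_le (f : Seq) :
    l2 (fun k : Chir × ℤ => ∑' y : ℤ, ‖f (site k.1 y k.2, k.1)‖ₑ) ≤
      2 ^ (1 / 2 : ℝ) * normB f := by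
  have h1 : ∀ k : Chir × ℤ, ∑' y : ℤ, ‖f (site k.1 y k.2, k.1)‖ₑ ≤
      ∑' j, ∑' y : ℤ, (shell j).indicator (fun i => ‖f i‖ₑ) (site k.1 y k.2, k.1) := fun k => by
    rw [ENNReal.tsum_comm]
    refine ENNReal.tsum_le_tsum fun y => ?_
    refine le_trans (le_of_eq ?_) (ENNReal.le_tsum (long (site k.1 y k.2, k.1)).natAbs.size)
    rw [Set.indicator_of_mem ((mem_shell_iff _ _).2 rfl)]
  refine (l2_mono h1).trans ((l2_tsum_le _).trans ?_)
  unfold normB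
  rw [← ENNReal.tsum_mul_left]
  refine ENNReal.tsum_le_tsum fun j => ?_
  rw [l2_le_iff]
  let s : Finset ℤ := Finset.Ioo (-(2 ^ j)) (2 ^ j)
  have hs : (s.card : ℝ≥0∞) ≤ 2 * 2 ^ j := by
    have : s.card ≤ 2 * 2 ^ j := by
      have e : ((2 : ℤ) ^ j) = ((2 ^ j : ℕ) : ℤ) := by push_cast; rfl
      simp only [s, Int.card_Ioo, e]; omega
    exact_mod_cast this
  have hsupp : ∀ k : Chir × ℤ, ∀ y ∉ s,
      (shell j).indicator (fun i => ‖f i‖ₑ) (site k.1 y k.2, k.1) = 0 := fun k y hy => by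
    refine Set.indicator_of_notMem (fun hm => hy ?_) _
    have h2 := hm.2
    rw [long_site] at h2
    have e : ((2 : ℤ) ^ j) = ((2 ^ j : ℕ) : ℤ) := by push_cast; rfl
    simp only [s, Finset.mem_Ioo, e]; omega
  calc ∑' k : Chir × ℤ,
        (∑' y : ℤ, (shell j).indicator (fun i => ‖f i‖ₑ) (site k.1 y k.2, k.1)) ^ 2
      ≤ ∑' k : Chir × ℤ, 2 * 2 ^ j *
        ∑' y : ℤ, (shell j).indicator (fun i => ‖f i‖ₑ ^ 2) (site k.1 y k.2, k.1) := by
        refine ENNReal.tsum_le_tsum fun k => ?_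
        rw [tsum_eq_sum (hsupp k)]
        have h3 := ENNReal.rpow_sum_le_const_mul_sum_rpow s
          (fun y => (shell j).indicator (fun i => ‖f i‖ₑ) (site k.1 y k.2, k.1))
          (p := 2) one_le_two
        norm_num at h3
        refine h3.trans (mul_le_mul' hs ?_)
        refine le_trans (Finset.sum_le_sum fun y _ => ?_) (ENNReal.sum_le_tsum s)
        by_cases hi : ((site k.1 y k.2, k.1) : Idx) ∈ shell j <;> simp [hi]
    _ = 2 * 2 ^ j * ∑' k : (Chir × ℤ) × ℤ,
          (shell j).indicator (fun i => ‖f i‖ₑ ^ 2) (site k.1.1 k.2 k.1.2, k.1.1) := by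
        rw [ENNReal.tsum_mul_left, ENNReal.tsum_prod' (α := Chir × ℤ)]
    _ ≤ 2 * 2 ^ j * ∑' i, (shell j).indicator (fun i => ‖f i‖ₑ ^ 2) i := by
        gcongr
        exact ENNReal.tsum_comp_le_tsum_of_injective site_injective _
    _ = (2 ^ (1 / 2 : ℝ) * (wt j * shellNorm j f)) ^ 2 := by
        rw [mul_pow, mul_pow, shellNorm, l2_sq, tsum_subtype (shell j) (fun i => ‖f i‖ₑ ^ 2), wt,
          sqrt_sq, sqrt_sq, mul_assoc]

theorem sqrt_two_lt_top : (2 : ℝ≥0∞) ^ (1 / 2 : ℝ) < ∞ :=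
  ENNReal.rpow_lt_top_of_nonneg (by norm_num) (by simp)

theorem enorm_fourier0_term (θ : ℝ) (n : ℤ) (w : ℂ) :
    ‖Complex.exp (-(Complex.I * θ * n)) * w‖ₑ = ‖w‖ₑ := by
  have : ‖Complex.exp (-(Complex.I * θ * n))‖ = 1 := by
    rw [Complex.norm_exp]; simp
  rw [enorm_mul, ← ofReal_norm, this]; simp

theorem summable_fourier0 (θ : ℝ) (f : SpaceB) (k : Chir × ℤ) : Summable fun y : ℤ =>
    Complex.exp (-(Complex.I * θ * (k.1.sign * y : ℤ))) * f.seq (site k.1 y k.2, k.1) := by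
  have h := (le_l2 (fun k : Chir × ℤ => ∑' y : ℤ, ‖f.seq (site k.1 y k.2, k.1)‖ₑ) k).trans
    (l2_line_le f.seq)
  have h2 : ∑' y : ℤ, ‖Complex.exp (-(Complex.I * θ * (k.1.sign * y : ℤ))) *
      f.seq (site k.1 y k.2, k.1)‖ₑ < ∞ := by
    simp_rw [enorm_fourier0_term]
    exact h.trans_lt (ENNReal.mul_lt_top sqrt_two_lt_top f.lt_top)
  refine Summable.of_norm ?_
  have h3 := ENNReal.summable_toReal h2.ne
  simpa using h3

theorem enorm_fourier0Seq_le (θ : ℝ) (f : Seq) (k : Chir × ℤ) :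
    ‖fourier0Seq θ f k‖ₑ ≤ ∑' y : ℤ, ‖f (site k.1 y k.2, k.1)‖ₑ := by
  unfold fourier0Seq
  rw [enorm_mul]
  have h1 : ‖((1 / Real.sqrt (2 * Real.pi) : ℝ) : ℂ)‖ₑ ≤ 1 := by
    rw [← ofReal_norm, Complex.norm_real, Real.norm_of_nonneg (by positivity)]
    rw [← ENNReal.ofReal_one]
    refine ENNReal.ofReal_le_ofReal ?_
    rw [div_le_one (by positivity), Real.one_le_sqrt]
    linarith [Real.pi_gt_three]
  calc _ ≤ 1 * ∑' y : ℤ, ‖Complex.exp (-(Complex.I * θ * (k.1.sign * y : ℤ))) *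
      f (site k.1 y k.2, k.1)‖ₑ := by gcongr; exact enorm_tsum_le_tsum_enorm
    _ = _ := by rw [one_mul]; simp_rw [enorm_fourier0_term]

theorem l2_fourier0Seq_le (θ : ℝ) (f : Seq) :
    l2 (fun k => ‖fourier0Seq θ f k‖ₑ) ≤ 2 ^ (1 / 2 : ℝ) * normB f :=
  (l2_mono (enorm_fourier0Seq_le θ f)).trans (l2_line_le f)

theorem memℓp_fourier0Seq (θ : ℝ) (f : SpaceB) : Memℓp (fourier0Seq θ f.seq) 2 :=
  (memℓp_iff_l2 _).2
    ((l2_fourier0Seq_le θ f.seq).trans_lt (ENNReal.mul_lt_top sqrt_two_lt_top f.lt_top)).ne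

/-- The Fourier transformation `𝓕⁽⁰⁾(θ)` as a bounded operator from `𝓑` to `h(θ)`. -/
def fourier0 (θ : ℝ) : SpaceB →L[ℂ] SpaceH :=
  LinearMap.mkContinuous
    { toFun := fun f => (⟨fourier0Seq θ f.seq, memℓp_fourier0Seq θ f⟩ : SpaceH)
      map_add' := fun f g => Subtype.ext (funext fun k => by
        change fourier0Seq θ (SpaceB.seq (f + g)) k = fourier0Seq θ f.seq k + fourier0Seq θ g.seq k
        simp only [fourier0Seq]
        rw [← mul_add, ← (summable_fourier0 θ f k).tsum_add (summable_fourier0 θ g k)]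
        simp [mul_add])
      map_smul' := fun c f => Subtype.ext (funext fun k => by
        change fourier0Seq θ (SpaceB.seq (c • f)) k = c * fourier0Seq θ f.seq k
        simp only [fourier0Seq]
        rw [mul_left_comm, ← tsum_mul_left (a := c)]
        simp only [map_smul, Pi.smul_apply, smul_eq_mul, mul_left_comm c]) }
    ((2 : ℝ≥0∞) ^ (1 / 2 : ℝ)).toReal fun f => by
      have h := l2_fourier0Seq_le θ f.seq
      rw [← f.enorm_eq] at h
      have h2 : ‖(⟨fourier0Seq θ f.seq, memℓp_fourier0Seq θ f⟩ : SpaceH)‖ₑ ≤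
        2 ^ (1 / 2 : ℝ) * ‖f‖ₑ := by rw [enorm_lp]; exact h
      have h3 := ENNReal.toReal_mono (ENNReal.mul_ne_top sqrt_two_lt_top.ne enorm_ne_top) h2
      rwa [ENNReal.toReal_mul, toReal_enorm, toReal_enorm] at h3

/-- The distorted Fourier transformation `𝓕⁽⁺⁾(θ) = 𝓕⁽⁰⁾(θ) (1 - V R(θ + i0))`. -/
def distortedFourier (C : Coin) (θ : ℝ) : SpaceB →L[ℂ] SpaceH :=
  fourier0 θ ∘L (ContinuousLinearMap.id ℂ SpaceB - pertBsB C ∘L boundaryResolvent C θ)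

/-! ### Adjoints -/

/-- Every `f ∈ 𝓑` is the sum of the series `∑ f_p(x) δ_{(x, p)}` in `𝓑`. -/
theorem hasSum_delta (f : SpaceB) : HasSum (fun i => f.seq i • delta i) f := by
  classical
  have hseq : ∀ (s : Finset Idx) (i : Idx),
      (SpaceB.seq (f - ∑ i ∈ s, f.seq i • delta i)) i = if i ∈ s then 0 else f.seq i := by
    intro s i
    have h1 : SpaceB.seq (∑ i ∈ s, f.seq i • delta i) = fun i => if i ∈ s then f.seq i else 0 := by
      rw [← eq_sum_delta s (fun i => if i ∈ s then f.seq i else 0) (by intro i hi; simp [hi])]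
      congr 1
      exact Finset.sum_congr rfl fun i hi => by simp [hi]
    rw [map_sub, Pi.sub_apply, h1]
    by_cases hi : i ∈ s <;> simp [hi]
  have hle : ∀ (s : Finset Idx) (j : ℕ),
      shellNorm j (SpaceB.seq (f - ∑ i ∈ s, f.seq i • delta i)) ≤ shellNorm j f.seq := by
    intro s j
    refine l2_mono fun i => ?_
    rw [hseq]; split_ifs <;> simp
  have htail : ∀ j, Filter.Tendsto
      (fun s : Finset Idx => shellNorm j (SpaceB.seq (f - ∑ i ∈ s, f.seq i • delta i)))
      Filter.atTop (nhds 0) := by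
    intro j
    have hf : ∑' i, ‖f.seq i‖ₑ ^ 2 ≠ ∞ := by
      rw [← l2_sq]
      exact ENNReal.pow_ne_top ((memℓp_iff_l2 _).1 (memℓp_of_normB_lt_top f))
    have h2 := (ENNReal.tendsto_tsum_compl_atTop_zero hf).ennrpow_const (1 / 2 : ℝ)
    rw [ENNReal.zero_rpow_of_pos (by norm_num)] at h2
    refine tendsto_of_tendsto_of_tendsto_of_le_of_le tendsto_const_nhds h2
      (fun _ => bot_le) fun s => (shellNorm_le_l2 j _).trans ?_
    refine ENNReal.rpow_le_rpow (le_of_eq ?_) (by norm_num)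
    have h3 := tsum_subtype {i | i ∉ s} (fun i => ‖f.seq i‖ₑ ^ 2)
    refine Eq.trans (tsum_congr fun i => ?_) h3.symm
    beta_reduce
    rw [hseq]
    by_cases hi : i ∈ s <;> simp [hi]
  have hnt : ∀ j, wt j * shellNorm j f.seq ≠ ∞ := fun j =>
    ((ENNReal.le_tsum j).trans_lt f.lt_top).ne
  have hmain : Filter.Tendsto (fun s : Finset Idx =>
      ∑' j, (wt j * shellNorm j (SpaceB.seq (f - ∑ i ∈ s, f.seq i • delta i))).toReal)
      Filter.atTop (nhds (∑' _ : ℕ, (0 : ℝ))) := by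
    refine tendsto_tsum_of_dominated_convergence
      (bound := fun j => (wt j * shellNorm j f.seq).toReal)
      (ENNReal.summable_toReal f.lt_top.ne) (fun j => ?_) (Filter.Eventually.of_forall fun s j => ?_)
    · have h4 := ENNReal.Tendsto.const_mul (a := wt j) (htail j) (Or.inr (wt_ne_top j))
      rw [mul_zero] at h4
      exact (ENNReal.tendsto_toReal ENNReal.zero_ne_top).comp h4
    · rw [Real.norm_of_nonneg ENNReal.toReal_nonneg]
      exact ENNReal.toReal_mono (hnt j) (by gcongr; exact hle s j)
  rw [tsum_zero] at hmain
  rw [HasSum, SummationFilter.unconditional_filter, tendsto_iff_norm_sub_tendsto_zero]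
  refine hmain.congr fun s => ?_
  rw [norm_sub_rev]
  change _ = (normB _).toReal
  rw [normB, ENNReal.tsum_toReal_eq]
  intro j
  exact ne_top_of_le_ne_top (hnt j) (by gcongr; exact hle s j)

/-- The sequence representing the functional `f ↦ (φ, T f)` on `𝓑`. -/
def adjointSeq (T : SpaceB →L[ℂ] SpaceH) (φ : SpaceH) : Seq := fun i => inner ℂ (T (delta i)) φ

theorem normBs_adjointSeq_le (T : SpaceB →L[ℂ] SpaceH) (φ : SpaceH) :
    normBs (adjointSeq T φ) ≤ ENNReal.ofReal (‖T‖ * ‖φ‖) := by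
  classical
  refine iSup_le fun j => ?_
  rw [← ENNReal.div_eq_inv_mul, ENNReal.div_le_iff (wt_ne_zero j) (wt_ne_top j)]
  set u := adjointSeq T φ with hu
  set K : ℝ := ‖T‖ * ‖φ‖ with hK
  rw [shellNorm, l2_le_iff, ENNReal.tsum_eq_iSup_sum]
  refine iSup_le fun t => ?_
  let s : Finset Idx := t.map (Function.Embedding.subtype _)
  have hs : ∀ i ∈ s, i ∈ shell j := by
    intro i hi
    obtain ⟨k, -, rfl⟩ := Finset.mem_map.1 hi
    exact k.2
  have hsum : ∑ i ∈ t, ‖u i‖ₑ ^ 2 = ∑ i ∈ s, ‖u i‖ₑ ^ 2 := by simp [s]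
  rw [hsum]
  let f : Seq := fun i => if i ∈ s then u i else 0
  let g : SpaceB := ∑ i ∈ s, f i • delta i
  have hg : g.seq = f := eq_sum_delta s f fun i hi => by simp [f, hi]
  have hnorm : ‖g‖ₑ ≤ wt j * (∑ i ∈ s, ‖u i‖ₑ ^ 2) ^ (1 / 2 : ℝ) := by
    rw [SpaceB.enorm_eq, hg, normB_of_shell j]
    · gcongr
      refine (shellNorm_le_l2 j f).trans (le_of_eq ?_)
      unfold l2
      rw [tsum_eq_sum (s := s)]
      · congr 1
        exact Finset.sum_congr rfl fun i hi => by simp [f, hi]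
      · intro i hi; simp [f, hi]
    · intro i hi
      have : i ∉ s := fun h => hi (hs i h)
      simp [f, this]
  have hin : inner ℂ (T g) φ = ((∑ i ∈ s, ‖u i‖ ^ 2 : ℝ) : ℂ) := by
    simp only [g, map_sum, map_smul, sum_inner, inner_smul_left]
    rw [Complex.ofReal_sum]
    refine Finset.sum_congr rfl fun i hi => ?_
    change (starRingEnd ℂ) (f i) * u i = _
    simp only [f, hi, if_true]
    rw [← Complex.normSq_eq_conj_mul_self, Complex.normSq_eq_norm_sq]
  have hE : ∑ i ∈ s, ‖u i‖ₑ ^ 2 = ENNReal.ofReal (∑ i ∈ s, ‖u i‖ ^ 2) := by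
    rw [ENNReal.ofReal_sum_of_nonneg fun _ _ => by positivity]
    refine Finset.sum_congr rfl fun i _ => ?_
    rw [← ofReal_norm, ← ENNReal.ofReal_pow (norm_nonneg _)]
  have hb : (∑ i ∈ s, ‖u i‖ ^ 2 : ℝ) ≤ K * ‖g‖ := by
    have h1 : ‖inner ℂ (T g) φ‖ ≤ ‖T g‖ * ‖φ‖ := norm_inner_le_norm _ _
    rw [hin, Complex.norm_real, Real.norm_of_nonneg (by positivity)] at h1
    calc _ ≤ ‖T g‖ * ‖φ‖ := h1
      _ ≤ (‖T‖ * ‖g‖) * ‖φ‖ := by gcongr; exact T.le_opNorm g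
      _ = K * ‖g‖ := by rw [hK]; ring
  set E := ∑ i ∈ s, ‖u i‖ₑ ^ 2 with hEdef
  have hEtop : E ≠ ∞ := by rw [hE]; exact ENNReal.ofReal_ne_top
  have h5 : E ≤ ENNReal.ofReal K * (wt j * E ^ (1 / 2 : ℝ)) := by
    calc E ≤ ENNReal.ofReal (K * ‖g‖) := by rw [hE]; exact ENNReal.ofReal_le_ofReal hb
      _ = ENNReal.ofReal K * ‖g‖ₑ := by
        rw [ENNReal.ofReal_mul (by positivity), ofReal_norm]
      _ ≤ _ := by gcongr
  by_cases hz : E = 0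
  · rw [hz]; exact zero_le
  have hz2 : E ^ (1 / 2 : ℝ) ≠ 0 := by
    intro h; exact hz ((ENNReal.rpow_eq_zero_iff_of_pos (by norm_num)).1 h)
  have hz3 : E ^ (1 / 2 : ℝ) ≠ ∞ := ENNReal.rpow_ne_top_of_nonneg (by norm_num) hEtop
  have h6 : E ^ (1 / 2 : ℝ) * E ^ (1 / 2 : ℝ) ≤ ENNReal.ofReal K * wt j * E ^ (1 / 2 : ℝ) := by
    rw [← sq, sqrt_sq, mul_assoc]; exact h5
  have h7 := (ENNReal.mul_le_mul_iff_left hz2 hz3).1 h6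
  calc E = (E ^ (1 / 2 : ℝ)) ^ 2 := (sqrt_sq E).symm
    _ ≤ _ := by gcongr

/-- The adjoint `T* : h(θ) → 𝓑*` of a bounded operator `T : 𝓑 → h(θ)`, where `𝓑*` is identified
with the dual of `𝓑` through the pairing `(u, f) = ∑_x ⟨u(x), f(x)⟩`; it is characterised by
`(T* φ, f) = (φ, T f)` for all `f ∈ 𝓑`, see `pairing_adjoint`. -/
def adjoint (T : SpaceB →L[ℂ] SpaceH) : SpaceH →L[ℂ] SpaceBs :=
  LinearMap.mkContinuous
    { toFun := fun φ => SpaceBs.mk (adjointSeq T φ)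
        ((normBs_adjointSeq_le T φ).trans_lt ENNReal.ofReal_lt_top)
      map_add' := fun φ ψ => SpaceBs.ext (funext fun i =>
        inner_add_right (T (delta i)) φ ψ)
      map_smul' := fun c φ => SpaceBs.ext (funext fun i =>
        inner_smul_right (T (delta i)) φ c) }
    ‖T‖ fun φ => ENNReal.toReal_le_of_le_ofReal (by positivity) (normBs_adjointSeq_le T φ)

/-- The identity `(T* φ, f) = (φ, T f)`, the series on the left being absolutely convergent.
Mathlib's inner product is conjugate linear in its first argument. -/
theorem hasSum_pairing_adjoint (T : SpaceB →L[ℂ] SpaceH) (φ : SpaceH) (f : SpaceB) :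
    HasSum (fun i => (adjoint T φ).seq i * (starRingEnd ℂ) (f.seq i)) (inner ℂ (T f) φ) := by
  have h1 := (hasSum_delta f).mapL T
  have h2 := h1.mapL (innerSL ℂ φ)
  have h3 := h2.map (starRingEnd ℂ) Complex.continuous_conj
  simp only [innerSL_apply_apply, inner_conj_symm] at h3
  refine h3.congr_fun fun i => ?_
  simp only [Function.comp_apply, map_smul, inner_conj_symm, inner_smul_left]
  rw [mul_comm]
  rfl

theorem pairing_adjoint (T : SpaceB →L[ℂ] SpaceH) (φ : SpaceH) (f : SpaceB) :
    pairing (adjoint T φ).seq f.seq = inner ℂ (T f) φ :=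
  (hasSum_pairing_adjoint T φ f).tsum_eq

end QuantumWalk

end

noncomputable section

namespace QuantumWalk

/-! ### Lines -/

/-! Write l = e^{iθ} and R₀(z) = (S - z)⁻¹ = ∑ zⁿ S⁻ⁿ⁻¹. Since S only translates along lines, R₀(z)
f is bounded at each site by the ℓ¹-norm of f on the line through it, uniformly for |z| ≤ 1.
Elements of 𝓑 have square summable line sums (`l2_line_le`), and square summable functions of the
line lie in 𝓑* (`normBs_le_of_line`). So R₀(z) maps 𝓑 to 𝓑* up to and including the unit circle, and
its matrix elements have limits there.

The heart of the matter is that W = 1 + V R₀(l) is invertible on 𝓑. The range of V is supported in a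
fixed finite set, so this is a question about a finite matrix (`resMatrix`) and injectivity suffices
(`eq_zero_of_add_pert`). If f + V R₀(l) f = 0, then f has finite support, and u = R₀(l) f solves U u
= l u and vanishes far out at one end of every line. Unitarity of the coins balances the flux
through a large box, which forces u to vanish at the other end as well (`outgoing_eq_zero`), so u
has finite support. The determinant condition then propagates zeros diagonally across the lattice
(`eq_zero_of_finite_support`); hence u = 0 and f = -V u = 0.

For |z| < 1 the ℓ² resolvent satisfies R(z) = R₀(z)(1 - V R(z)), where V R(z) f solves a finite
linear system. Letting z tend to l gives R(θ + i0), with 1 - V R(θ + i0) = W⁻¹ and therefore 𝓕⁽⁺⁾ =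
𝓕⁽⁰⁾ W⁻¹. Surjectivity is inherited from 𝓕⁽⁰⁾.

For the eigenfunctions, W (S - l) δ = (U - l) δ (`waveB_shiftDelta`). Because the coins are unitary
and |l| = 1, u ∈ 𝓑* is an eigenfunction exactly when its functional kills all (U - l) δ
(`evol_eq_iff`), that is, when its composition with W kills all (S - l) δ. The functionals with the
latter property are those given by 𝓕⁽⁰⁾* φ (`exists_adjointFunctional_eq`, `fourier0_shiftDelta`);
composing with W⁻¹ turns them into 𝓕⁽⁺⁾* φ. -/

/-- The coordinate transversal to the direction of motion. -/
def transv : Idx → ℤ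
  | (x, .left) => x.2
  | (x, .right) => x.2
  | (x, .down) => x.1
  | (x, .up) => x.1

theorem site_long_transv (i : Idx) : site i.2 (long i) (transv i) = i.1 := by
  obtain ⟨⟨x, y⟩, p⟩ := i
  cases p <;> rfl

theorem transv_site (p : Chir) (y z : ℤ) : transv (site p y z, p) = z := by cases p <;> rfl

theorem site_add_step (p : Chir) (y z m : ℤ) :
    site p y z + m • p.step = site p (y + m * p.sign) z := by
  cases p <;> simp [site, Chir.step, Chir.sign]

theorem long_add_step (i : Idx) (m : ℤ) :
    long (i.1 + m • i.2.step, i.2) = long i + m * i.2.sign := by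
  conv_lhs => rw [← site_long_transv i, site_add_step, long_site]

theorem transv_add_step (i : Idx) (m : ℤ) :
    transv (i.1 + m • i.2.step, i.2) = transv i := by
  conv_lhs => rw [← site_long_transv i, site_add_step, transv_site]

theorem sign_mul_sign (p : Chir) : p.sign * p.sign = 1 := by cases p <;> rfl

/-- The decomposition of the set of pairs (position, chirality) into lines. -/
def lineEquiv : (Chir × ℤ) × ℤ ≃ Idx where
  toFun k := (site k.1.1 k.2 k.1.2, k.1.1)
  invFun i := ((i.2, transv i), long i)
  left_inv k := by simp [long_site, transv_site]
  right_inv i := Prod.ext (site_long_transv i) rfl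

/-- The `ℓ¹`-norm of a sequence on a line. -/
def lineSum (f : Seq) (k : Chir × ℤ) : ℝ≥0∞ := ∑' y : ℤ, ‖f (site k.1 y k.2, k.1)‖ₑ

theorem lineSum_lt_top (f : SpaceB) (k : Chir × ℤ) : lineSum f.seq k < ∞ :=
  ((le_l2 (lineSum f.seq) k).trans (l2_line_le f.seq)).trans_lt
    (ENNReal.mul_lt_top sqrt_two_lt_top f.lt_top)

/-- The sites visited by the free resolvent series are distinct points of a single line, so their
sum is part of the line sum. -/
theorem tsum_enorm_back_le (f : Seq) (i : Idx) :
    ∑' n : ℕ, ‖f (i.1 - ((n : ℤ) + 1) • i.2.step, i.2)‖ₑ ≤ lineSum f (i.2, transv i) := by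
  have h : ∀ n : ℕ, ((i.1 - ((n : ℤ) + 1) • i.2.step, i.2) : Idx) =
      (site i.2 (long i + -((n : ℤ) + 1) * i.2.sign) (transv i), i.2) := fun n => by
    rw [← site_add_step, site_long_transv, neg_smul, sub_eq_add_neg]
  simp_rw [h]
  refine ENNReal.tsum_comp_le_tsum_of_injective
    (f := fun n : ℕ => long i + -((n : ℤ) + 1) * i.2.sign) (fun m n hmn => ?_)
    (fun y => ‖f (site i.2 y (transv i), i.2)‖ₑ)
  -- Multiplying by the sign once more removes it, since its square is 1.
  have h2 := congrArg (· * i.2.sign) (add_left_cancel hmn)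
  simp only [mul_assoc, sign_mul_sign] at h2
  omega

/-- Sequences dominated by a square summable function of the line belong to `𝓑*`. -/
theorem normBs_le_of_line {u : Seq} {c : Chir × ℤ → ℝ≥0∞}
    (h : ∀ i, ‖u i‖ₑ ≤ c (i.2, transv i)) : normBs u ≤ 2 ^ (1 / 2 : ℝ) * l2 c := by
  refine iSup_le fun j => ?_
  rw [← ENNReal.div_eq_inv_mul, ENNReal.div_le_iff (wt_ne_zero j) (wt_ne_top j), shellNorm,
    l2_le_iff]
  let s : Finset ℤ := Finset.Ioo (-(2 ^ j)) (2 ^ j)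
  have e : ((2 : ℤ) ^ j) = ((2 ^ j : ℕ) : ℤ) := by push_cast; rfl
  have hs : (s.card : ℝ≥0∞) ≤ 2 * 2 ^ j := by
    have : s.card ≤ 2 * 2 ^ j := by
      simp only [s, Int.card_Ioo, e]; omega
    exact_mod_cast this
  calc ∑' i : shell j, ‖u i‖ₑ ^ 2
      ≤ ∑' i : shell j, c ((i : Idx).2, transv i) ^ 2 :=
        ENNReal.tsum_le_tsum fun i => pow_le_pow_left₀ zero_le (h i) 2
    _ = ∑' i : Idx, (shell j).indicator (fun i => c (i.2, transv i) ^ 2) i :=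
        tsum_subtype (shell j) (fun i => c (i.2, transv i) ^ 2)
    _ = ∑' k : Chir × ℤ, ∑' y : ℤ,
          (shell j).indicator (fun i => c (i.2, transv i) ^ 2) (lineEquiv (k, y)) := by
        rw [← lineEquiv.tsum_eq, ENNReal.tsum_prod' (α := Chir × ℤ)]
    _ ≤ ∑' k : Chir × ℤ, 2 * 2 ^ j * c k ^ 2 := by
        refine ENNReal.tsum_le_tsum fun k => ?_
        -- A line meets the shell in at most 2 · 2^j sites, and the bound c is constant along the
        -- line.
        have hk : ∀ y, (shell j).indicator (fun i => c (i.2, transv i) ^ 2) (lineEquiv (k, y)) ≤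
            if y ∈ s then c k ^ 2 else 0 := fun y => by
          by_cases hy : lineEquiv (k, y) ∈ shell j
          · have h2 := hy.2
            simp only [lineEquiv, Equiv.coe_fn_mk, long_site] at h2
            have h3 : y ∈ s := by simp only [s, Finset.mem_Ioo, e]; omega
            rw [Set.indicator_of_mem hy, if_pos h3]
            simp [lineEquiv, transv_site]
          · rw [Set.indicator_of_notMem hy]; exact zero_le
        refine (ENNReal.tsum_le_tsum hk).trans ?_
        rw [tsum_eq_sum (s := s) (fun y hy => if_neg hy), Finset.sum_ite_mem, Finset.inter_self,
          Finset.sum_const, nsmul_eq_mul]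
        gcongr
    _ = (2 ^ (1 / 2 : ℝ) * l2 c * wt j) ^ 2 := by
        rw [ENNReal.tsum_mul_left, mul_pow, mul_pow, l2_sq, wt, sqrt_sq, sqrt_sq]
        ring

/-! ### The free resolvent -/

/-- The free resolvent `(S - z)⁻¹ = ∑_n zⁿ S⁻ⁿ⁻¹`. -/
def freeRes (z : ℂ) (f : Seq) : Seq := fun i =>
  ∑' n : ℕ, z ^ n * f (i.1 - ((n : ℤ) + 1) • i.2.step, i.2)

theorem norm_pow_mul_le {z : ℂ} (hz : ‖z‖ ≤ 1) (n : ℕ) (w : ℂ) : ‖z ^ n * w‖ ≤ ‖w‖ := by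
  rw [norm_mul, norm_pow]
  exact mul_le_of_le_one_left (norm_nonneg _) (pow_le_one₀ (norm_nonneg _) hz)

theorem enorm_pow_mul_le {z : ℂ} (hz : ‖z‖ ≤ 1) (n : ℕ) (w : ℂ) : ‖z ^ n * w‖ₑ ≤ ‖w‖ₑ := by
  rw [← ofReal_norm, ← ofReal_norm]
  exact ENNReal.ofReal_le_ofReal (norm_pow_mul_le hz n w)

theorem enorm_freeRes_le {z : ℂ} (hz : ‖z‖ ≤ 1) (f : Seq) (i : Idx) :
    ‖freeRes z f i‖ₑ ≤ lineSum f (i.2, transv i) :=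
  enorm_tsum_le_tsum_enorm.trans
    ((ENNReal.tsum_le_tsum fun n => enorm_pow_mul_le hz n _).trans (tsum_enorm_back_le f i))

theorem summable_norm_back (f : SpaceB) (i : Idx) :
    Summable fun n : ℕ => ‖f.seq (i.1 - ((n : ℤ) + 1) • i.2.step, i.2)‖ := by
  have h3 := ENNReal.summable_toReal
    ((tsum_enorm_back_le f.seq i).trans_lt (lineSum_lt_top f _)).ne
  simpa using h3

theorem summable_freeRes {z : ℂ} (hz : ‖z‖ ≤ 1) (f : SpaceB) (i : Idx) :
    Summable fun n : ℕ => z ^ n * f.seq (i.1 - ((n : ℤ) + 1) • i.2.step, i.2) :=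
  Summable.of_norm_bounded (summable_norm_back f i) fun n => norm_pow_mul_le hz n _

/-- Dominated convergence: the absolute values of f along the line dominate the series for every z
in the closed disc, so the limit point may lie on the circle. -/
theorem tendsto_freeRes {ι : Type} {l : Filter ι} {z : ι → ℂ} {w : ℂ}
    (hz : ∀ᶠ t in l, ‖z t‖ ≤ 1) (h : Filter.Tendsto z l (nhds w)) (f : SpaceB) (i : Idx) :
    Filter.Tendsto (fun t => freeRes (z t) f.seq i) l (nhds (freeRes w f.seq i)) := by
  refine tendsto_tsum_of_dominated_convergence (summable_norm_back f i)
    (fun n => (h.pow n).mul_const _) ?_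
  filter_upwards [hz] with t ht n using norm_pow_mul_le ht n _

/-- Applying S cancels one backward step: the n = 0 term becomes f, and the other terms carry a
factor z in front of the original series. -/
theorem freeRes_shift {z : ℂ} (hz : ‖z‖ ≤ 1) (f : SpaceB) :
    freeRes z (shift f.seq) = f.seq + z • freeRes z f.seq := by
  funext i
  have h : ∀ n : ℕ, z ^ n * shift f.seq (i.1 - ((n : ℤ) + 1) • i.2.step, i.2) =
      z ^ n * f.seq (i.1 - (n : ℤ) • i.2.step, i.2) := fun n => by
    change z ^ n * f.seq (i.1 - ((n : ℤ) + 1) • i.2.step + i.2.step, i.2) = _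
    rw [add_smul, one_smul, ← sub_sub, sub_add_cancel]
  have hs : ∀ n : ℕ, z ^ (n + 1) * f.seq (i.1 - ((n + 1 : ℕ) : ℤ) • i.2.step, i.2) =
      z * (z ^ n * f.seq (i.1 - ((n : ℤ) + 1) • i.2.step, i.2)) := fun n => by
    push_cast; ring
  have hsum : Summable fun n : ℕ => z ^ n * f.seq (i.1 - (n : ℤ) • i.2.step, i.2) := by
    rw [← summable_nat_add_iff 1]
    simp_rw [hs]
    exact (summable_freeRes hz f i).mul_left z
  simp only [freeRes, h, Pi.add_apply, Pi.smul_apply, smul_eq_mul]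
  rw [hsum.tsum_eq_zero_add]
  simp_rw [hs]
  rw [tsum_mul_left]
  simp

theorem shift_freeRes {z : ℂ} (hz : ‖z‖ ≤ 1) (f : SpaceB) :
    shift (freeRes z f.seq) = f.seq + z • freeRes z f.seq := by
  rw [← freeRes_shift hz f]
  funext i
  change freeRes z f.seq (i.1 + i.2.step, i.2) = _
  unfold freeRes
  refine tsum_congr fun n => ?_
  change _ = z ^ n * f.seq (i.1 - ((n : ℤ) + 1) • i.2.step + i.2.step, i.2)
  rw [add_sub_right_comm]

/-- The free resolvent as a bounded operator from `𝓑` to `𝓑*`. -/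
def freeResB (z : ℂ) (hz : ‖z‖ ≤ 1) : SpaceB →L[ℂ] SpaceBs :=
  LinearMap.mkContinuous
    { toFun := fun f => SpaceBs.mk (freeRes z f.seq)
        ((normBs_le_of_line (enorm_freeRes_le hz f.seq)).trans_lt
          (ENNReal.mul_lt_top sqrt_two_lt_top ((l2_line_le f.seq).trans_lt
            (ENNReal.mul_lt_top sqrt_two_lt_top f.lt_top))))
      map_add' := fun f g => SpaceBs.ext (funext fun i => by
        simp only [SpaceBs.seq_mk, map_add, Pi.add_apply, freeRes, mul_add]
        exact (summable_freeRes hz f i).tsum_add (summable_freeRes hz g i))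
      map_smul' := fun c f => SpaceBs.ext (funext fun i => by
        simp only [SpaceBs.seq_mk, map_smul, Pi.smul_apply, freeRes, smul_eq_mul,
          RingHom.id_apply, mul_left_comm _ c]
        exact tsum_mul_left) } 2 fun f => by
      have h : normBs (freeRes z f.seq) ≤ 2 * normB f.seq := by
        refine (normBs_le_of_line (enorm_freeRes_le hz f.seq)).trans ?_
        calc (2 : ℝ≥0∞) ^ (1 / 2 : ℝ) * l2 (lineSum f.seq)
            ≤ 2 ^ (1 / 2 : ℝ) * (2 ^ (1 / 2 : ℝ) * normB f.seq) := by
              gcongr; exact l2_line_le f.seq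
          _ = 2 * normB f.seq := by rw [← mul_assoc, ← sq, sqrt_sq]
      have h2 := ENNReal.toReal_mono (ENNReal.mul_ne_top (by simp) f.lt_top.ne) h
      rwa [ENNReal.toReal_mul] at h2

theorem seq_freeResB (z : ℂ) (hz : ‖z‖ ≤ 1) (f : SpaceB) :
    (freeResB z hz f).seq = freeRes z f.seq := rfl

/-! ### Duality of `𝓑` and `𝓑*` -/

theorem tsum_mul_le_l2 {ι : Type} (f g : ι → ℝ≥0∞) : ∑' i, f i * g i ≤ l2 f * l2 g := by
  rw [ENNReal.tsum_eq_iSup_sum]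
  refine iSup_le fun s => ?_
  refine (ENNReal.inner_le_Lp_mul_Lq s f g (p := 2) (q := 2)
    ⟨by norm_num, by norm_num, by norm_num⟩).trans ?_
  unfold l2
  gcongr <;> simp only [ENNReal.rpow_ofNat] <;> exact ENNReal.sum_le_tsum s

theorem shellNorm_le_normBs (u : Seq) (j : ℕ) : shellNorm j u ≤ wt j * normBs u := by
  rw [mul_comm, ← ENNReal.div_le_iff (wt_ne_zero _) (wt_ne_top _), ENNReal.div_eq_inv_mul]
  exact le_iSup (fun j => (wt j)⁻¹ * shellNorm j u) _

/-- Cauchy–Schwarz on each shell; the weights r_j^{1/2} and r_j^{-1/2} of the two norms cancel, and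
the shells partition the index set. -/
theorem tsum_mul_le (u f : Seq) : ∑' i, ‖u i‖ₑ * ‖f i‖ₑ ≤ normBs u * normB f := by
  have h : ∀ i, ‖u i‖ₑ * ‖f i‖ₑ ≤
      ∑' j, (shell j).indicator (fun i => ‖u i‖ₑ * ‖f i‖ₑ) i := fun i => by
    refine le_trans (le_of_eq ?_) (ENNReal.le_tsum (long i).natAbs.size)
    rw [Set.indicator_of_mem ((mem_shell_iff _ _).2 rfl)]
  refine (ENNReal.tsum_le_tsum h).trans ?_
  rw [ENNReal.tsum_comm, normB, ← ENNReal.tsum_mul_left]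
  refine ENNReal.tsum_le_tsum fun j => ?_
  rw [← tsum_subtype (shell j) (fun i => ‖u i‖ₑ * ‖f i‖ₑ)]
  calc _ ≤ shellNorm j u * shellNorm j f :=
        tsum_mul_le_l2 (fun i : shell j => ‖u i‖ₑ) (fun i : shell j => ‖f i‖ₑ)
    _ ≤ (wt j * normBs u) * shellNorm j f := by gcongr; exact shellNorm_le_normBs u j
    _ = _ := by ring

theorem summable_pairing (u : SpaceBs) (f : SpaceB) :
    Summable fun i => ‖u.seq i‖ * ‖f.seq i‖ := by
  have h3 := ENNReal.summable_toReal ((tsum_mul_le u.seq f.seq).trans_lt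
    (ENNReal.mul_lt_top u.lt_top f.lt_top)).ne
  simpa using h3

theorem summable_dual (u : SpaceBs) (f : SpaceB) :
    Summable fun i => (starRingEnd ℂ) (u.seq i) * f.seq i :=
  Summable.of_norm_bounded (summable_pairing u f) fun i => by simp

/-- The functional `f ↦ conj (u, f)` on `𝓑` given by `u ∈ 𝓑*`. -/
def dual (u : SpaceBs) : SpaceB →L[ℂ] ℂ :=
  LinearMap.mkContinuous
    { toFun := fun f => ∑' i, (starRingEnd ℂ) (u.seq i) * f.seq i
      map_add' := fun f g => by
        simp only [map_add, Pi.add_apply, mul_add]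
        exact (summable_dual u f).tsum_add (summable_dual u g)
      map_smul' := fun c f => by
        simp only [map_smul, Pi.smul_apply, smul_eq_mul, RingHom.id_apply, mul_left_comm _ c]
        exact tsum_mul_left } ‖u‖ fun f => by
      have h : ‖∑' i, (starRingEnd ℂ) (u.seq i) * f.seq i‖ₑ ≤ normBs u.seq * normB f.seq := by
        refine enorm_tsum_le_tsum_enorm.trans (le_trans (le_of_eq ?_) (tsum_mul_le u.seq f.seq))
        exact tsum_congr fun i => by rw [enorm_mul, ← ofReal_norm, RCLike.norm_conj, ofReal_norm]
      have h2 := ENNReal.toReal_mono (ENNReal.mul_ne_top u.lt_top.ne f.lt_top.ne) h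
      rwa [ENNReal.toReal_mul, toReal_enorm] at h2

theorem dual_delta (u : SpaceBs) (i : Idx) : dual u (delta i) = (starRingEnd ℂ) (u.seq i) := by
  change ∑' k, (starRingEnd ℂ) (u.seq k) * (Pi.single i 1 : Seq) k = _
  rw [tsum_eq_single i]
  · simp
  · intro k hk; simp [hk]

theorem pairing_delta (u : Seq) (i : Idx) : pairing u (delta i).seq = u i := by
  change ∑' k, u k * (starRingEnd ℂ) ((Pi.single i 1 : Seq) k) = _
  rw [tsum_eq_single i]
  · simp
  · intro k hk; simp [hk]

/-- Bounded functionals on `𝓑` which agree on the sequences `δ_{(x, p)}` are equal. -/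
theorem functional_ext {F : Type} [NormedAddCommGroup F] [NormedSpace ℂ F]
    {a b : SpaceB →L[ℂ] F} (h : ∀ i, a (delta i) = b (delta i)) (f : SpaceB) : a f = b f := by
  refine ((hasSum_delta f).mapL a).unique ?_
  simp only [map_smul, h]
  simpa only [map_smul] using (hasSum_delta f).mapL b

/-! ### Unique continuation and the flux identity -/

theorem coin_mul_of_evol {C : Coin} {u : Seq} {l : ℂ} (hu : evol C u = l • u) (x : ℤ × ℤ)
    (p : Chir) : ∑ q, C.mat x p q * u (x, q) = l * u (x - p.step, p) := by
  have h := congrFun hu (x - p.step, p)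
  change ∑ q, C.mat (x - p.step + p.step) p q * u (x - p.step + p.step, q) = _ at h
  rwa [sub_add_cancel] at h

/-- Off the perturbed square the coin is the identity, so the block is the identity too and no case
distinction is needed in the propagation argument. -/
theorem det_odd_ne_zero (C : Coin) (x : ℤ × ℤ) :
    ((C.mat x).submatrix ![Chir.left, Chir.down] ![Chir.left, Chir.down]).det ≠ 0 := by
  by_cases hx : |x.1| ≤ C.n₀ ∧ |x.2| ≤ C.n₀
  · exact C.det_odd x hx
  · rw [C.eq_one x hx, Matrix.det_fin_two]
    simp [Matrix.one_apply]

theorem sum_chir {M : Type} [AddCommMonoid M] (f : Chir → M) :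
    ∑ p, f p = f .left + f .right + f .down + f .up := by
  have h : (Finset.univ : Finset Chir) = {.left, .right, .down, .up} := rfl
  rw [h]
  simp [add_assoc]

/-- A finitely supported solution of `(U - l) u = 0` vanishes. -/
theorem eq_zero_of_finite_support {C : Coin} {u : Seq} {l : ℂ} (hl : l ≠ 0)
    (hu : evol C u = l • u) (N : ℤ) (hN : ∀ i : Idx, N < |i.1.1| ∨ N < |i.1.2| → u i = 0) :
    u = 0 := by
  -- Sweep along the antidiagonals x₁ + x₂ = const, starting below the square |x₁|, |x₂| ≤ N, where
  -- the sum is at least -2N.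
  have key : ∀ n : ℕ, ∀ x : ℤ × ℤ, x.1 + x.2 < -(2 * N) + n → ∀ p, u (x, p) = 0 := by
    intro n
    induction n with
    | zero =>
      intro x hx p
      refine hN _ ?_
      by_contra! h
      have h1 := (abs_le.1 h.1).1
      have h2 := (abs_le.1 h.2).1
      simp only [Nat.cast_zero] at *
      omega
    | succ n ih =>
      intro x hx
      have ih1 : ∀ p, u ((x.1 - 1, x.2), p) = 0 := ih _ (by push_cast at hx ⊢; omega)
      have ih2 : ∀ p, u ((x.1, x.2 - 1), p) = 0 := ih _ (by push_cast at hx ⊢; omega)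
      -- The components → and ↑ at x are images under the coins of the neighbours (x₁ - 1, x₂) and
      -- (x₁, x₂ - 1), which lie on the preceding antidiagonal.
      have hr : u (x, .right) = 0 := by
        have h := coin_mul_of_evol hu (x.1 - 1, x.2) .right
        simpa [ih1, hl, Chir.step] using h.symm
      have hup : u (x, .up) = 0 := by
        have h := coin_mul_of_evol hu (x.1, x.2 - 1) .up
        simpa [ih2, hl, Chir.step] using h.symm
      have h1 := coin_mul_of_evol hu x .left
      have h2 := coin_mul_of_evol hu x .down
      have e1 : x - Chir.left.step = (x.1 - 1, x.2) := by ext <;> simp [Chir.step]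
      have e2 : x - Chir.down.step = (x.1, x.2 - 1) := by ext <;> simp [Chir.step]
      rw [e1, ih1, mul_zero, sum_chir, hr, hup] at h1
      rw [e2, ih2, mul_zero, sum_chir, hr, hup] at h2
      -- The rows ← and ↓ of the equation at x also have zero right-hand side there, so the {←, ↓}
      -- block annihilates the two remaining components.
      have h3 := Matrix.eq_zero_of_mulVec_eq_zero (det_odd_ne_zero C x)
        (v := ![u (x, .left), u (x, .down)]) (by
          ext k
          fin_cases k
          · simpa [Matrix.mulVec, dotProduct, Fin.sum_univ_two] using h1
          · simpa [Matrix.mulVec, dotProduct, Fin.sum_univ_two] using h2)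
      intro p
      cases p
      · exact congrFun h3 0
      · exact hr
      · exact congrFun h3 1
      · exact hup
  funext i
  exact key (i.1.1 + i.1.2 + 2 * N + 1).toNat i.1 (by omega) i.2

theorem sum_coin_sq (C : Coin) (x : ℤ × ℤ) (v : Chir → ℂ) :
    ∑ p, ‖∑ q, C.mat x p q * v q‖ ^ 2 = ∑ p, ‖v p‖ ^ 2 := by
  have e1 : ∀ w : Chir → ℂ, ((∑ p, ‖w p‖ ^ 2 : ℝ) : ℂ) = dotProduct (star w) w := fun w => by
    simp only [dotProduct, Complex.ofReal_sum, Pi.star_apply]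
    refine Finset.sum_congr rfl fun p _ => ?_
    rw [RCLike.star_def, ← Complex.normSq_eq_conj_mul_self, Complex.normSq_eq_norm_sq]
  have e3 := e1 ((C.mat x).mulVec v)
  rw [Matrix.star_mulVec, ← Matrix.dotProduct_mulVec, Matrix.mulVec_mulVec,
    ← Matrix.star_eq_conjTranspose, (Matrix.mem_unitaryGroup_iff').1 (C.mem_unitary x),
    Matrix.one_mulVec, ← e1] at e3
  exact_mod_cast e3

theorem sum_sub_pred (g : ℤ → ℝ) (a : ℤ) (n : ℕ) :
    ∑ y ∈ Finset.Icc a (a + n), (g y - g (y - 1)) = g (a + n) - g (a - 1) := by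
  induction n with
  | zero => simp
  | succ n ih =>
    have h : Finset.Icc a (a + (n + 1 : ℕ)) = insert (a + (n + 1 : ℕ)) (Finset.Icc a (a + n)) := by
      ext y; simp only [Finset.mem_Icc, Finset.mem_insert]; push_cast; omega
    rw [h, Finset.sum_insert (by simp), ih]
    push_cast
    rw [show a + ((n : ℤ) + 1) - 1 = a + n by ring]
    ring

/-- Telescoping in the direction of p: one value survives at the last site of the interval and one
just outside its opposite end, whence N against -N - 1. -/
theorem sum_sub_sign (g : ℤ → ℝ) (p : Chir) (N : ℕ) :
    ∑ y ∈ Finset.Icc (-(N : ℤ)) N, (g y - g (y - p.sign)) =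
      g (p.sign * N) - g (p.sign * (-N - 1)) := by
  have h : ∀ g : ℤ → ℝ, ∑ y ∈ Finset.Icc (-(N : ℤ)) N, (g y - g (y - 1)) = g N - g (-N - 1) :=
    fun g => by
      have h := sum_sub_pred g (-N) (2 * N)
      push_cast at h
      rwa [show -(N : ℤ) + 2 * N = N by ring] at h
  have h2 := h fun y => g (y + 1)
  simp only [sub_add_cancel] at h2
  have h3 : ∑ y ∈ Finset.Icc (-(N : ℤ)) N, (g y - g (y - -1)) = g (-N) - g (N + 1) := by
    rw [← neg_inj, ← Finset.sum_neg_distrib]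
    simp only [neg_sub, sub_neg_eq_add]
    exact h2
  cases p
  · simpa [Chir.sign] using h g
  · simpa [Chir.sign, add_comm] using h3
  · simpa [Chir.sign] using h g
  · simpa [Chir.sign, add_comm] using h3

theorem sum_box (N : ℕ) (p : Chir) (g : ℤ × ℤ → ℝ) :
    ∑ x ∈ Finset.Icc (-(N : ℤ)) N ×ˢ Finset.Icc (-(N : ℤ)) N, g x =
      ∑ z ∈ Finset.Icc (-(N : ℤ)) N, ∑ y ∈ Finset.Icc (-(N : ℤ)) N, g (site p y z) := by
  cases p
  · exact Finset.sum_product_right _ _ _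
  · exact Finset.sum_product_right _ _ _
  · exact Finset.sum_product _ _ _
  · exact Finset.sum_product _ _ _

/-- A solution of `(U - l) u = 0` without incoming part has no outgoing part. -/
theorem outgoing_eq_zero {C : Coin} {u : Seq} {l : ℂ} (hl : ‖l‖ = 1)
    (hu : evol C u = l • u) (N : ℕ)
    (hin : ∀ i : Idx, i.2.sign * long i ≤ -N → u i = 0)
    (htr : ∀ i : Idx, (N : ℤ) < |transv i| → u i = 0) (i : Idx)
    (hi : i.2.sign * long i = N) : u i = 0 := by
  -- Flux balance: at each site the unitary coin preserves ∑ |u_p(x)|², and the eigenvalue equation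
  -- with |l| = 1 identifies its output with the values one step back.
  have h0 : ∑ x ∈ Finset.Icc (-(N : ℤ)) N ×ˢ Finset.Icc (-(N : ℤ)) N,
      ∑ p, (‖u (x, p)‖ ^ 2 - ‖u (x - p.step, p)‖ ^ 2) = 0 := by
    refine Finset.sum_eq_zero fun x _ => ?_
    have h1 := sum_coin_sq C x fun q => u (x, q)
    simp only [coin_mul_of_evol hu, norm_mul, hl, one_mul] at h1
    rw [Finset.sum_sub_distrib, h1, sub_self]
  have hstep : ∀ p y z, site p y z - p.step = site p (y - p.sign) z := fun p y z => by
    have := site_add_step p y z (-1)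
    rw [neg_one_smul, neg_one_mul] at this
    exact this
  rw [Finset.sum_comm] at h0
  -- For each chirality, sum along its own lines, so that only boundary terms remain.
  simp_rw [fun p => sum_box N p fun x => ‖u (x, p)‖ ^ 2 - ‖u (x - p.step, p)‖ ^ 2, hstep] at h0
  simp_rw [fun p z => sum_sub_sign (fun y => ‖u (site p y z, p)‖ ^ 2) p N] at h0
  -- The terms at the end where u is known to vanish drop out; a sum of squares equal to zero is
  -- left.
  have hz : ∀ p z, u (site p (p.sign * (-N - 1)) z, p) = 0 := fun p z => by
    refine hin _ ?_
    rw [long_site, ← mul_assoc, sign_mul_sign]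
    omega
  simp only [hz, norm_zero, ne_eq, OfNat.ofNat_ne_zero, not_false_eq_true, zero_pow, sub_zero]
    at h0
  rw [Finset.sum_eq_zero_iff_of_nonneg fun p _ => Finset.sum_nonneg fun z _ => by positivity] at h0
  have h1 := h0 i.2 (Finset.mem_univ _)
  rw [Finset.sum_eq_zero_iff_of_nonneg fun z _ => by positivity] at h1
  by_cases ht : (N : ℤ) < |transv i|
  · exact htr i ht
  have h2 := h1 (transv i) (Finset.mem_Icc.2 (abs_le.1 (not_lt.1 ht)))
  rw [← hi, ← mul_assoc, sign_mul_sign, one_mul, site_long_transv] at h2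
  simpa using h2

theorem abs_sign_mul (p : Chir) (a : ℤ) : |p.sign * a| = |a| := by
  cases p <;> simp [Chir.sign]

theorem abs_coord_cases (N : ℤ) (i : Idx) (h : N < |i.1.1| ∨ N < |i.1.2|) :
    N < |long i| ∨ N < |transv i| := by
  obtain ⟨⟨x, y⟩, p⟩ := i
  cases p <;> simp only [long, transv] at * <;> tauto

/-- There is no non-zero `f` with `f + V R₀ f = 0`. -/
theorem eq_zero_of_add_pert (C : Coin) {l : ℂ} (hl : ‖l‖ = 1) (f : SpaceB)
    (hf : f.seq + pert C (freeRes l f.seq) = 0) : f.seq = 0 := by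
  set u := freeRes l f.seq with hudef
  have hshift : shift u = f.seq + l • u := shift_freeRes hl.le f
  have hu : evol C u = l • u := by
    have h : evol C u = pert C u + shift u := by simp [pert]
    rw [h, hshift, ← add_assoc, add_comm _ f.seq, hf, zero_add]
  obtain ⟨s, hs⟩ := pert_support C
  have hfs : ∀ i ∉ s, f.seq i = 0 := fun i hi => by
    have := congrFun hf i
    simpa [hs u i hi] using this
  obtain ⟨N, hN⟩ : ∃ N : ℕ, ∀ i ∈ s, |long i| < N ∧ |transv i| < N := by
    -- The summand 1 makes the bounds strict, so f vanishes already at coordinates of modulus N.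
    refine ⟨∑ i ∈ s, ((long i).natAbs + (transv i).natAbs) + 1, fun i hi => ?_⟩
    have := Finset.single_le_sum (f := fun i => (long i).natAbs + (transv i).natAbs)
      (fun _ _ => Nat.zero_le _) hi
    constructor <;> · rw [Int.abs_eq_natAbs]; exact_mod_cast (by omega)
  have hfN : ∀ i, (N : ℤ) ≤ |long i| ∨ (N : ℤ) ≤ |transv i| → f.seq i = 0 := fun i hi => by
    refine hfs i fun h => ?_
    have := hN i h
    omega
  -- R₀ f at i involves f only at sites with smaller `sign * long`, here all below -N and so outside
  -- the support of f.
  have hin : ∀ i : Idx, i.2.sign * long i ≤ -N → u i = 0 := fun i hi => by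
    refine (tsum_congr fun n : ℕ => ?_).trans tsum_zero
    rw [hfN _ (Or.inl ?_), mul_zero]
    have e := long_add_step i (-((n : ℤ) + 1))
    rw [neg_smul, ← sub_eq_add_neg] at e
    rw [e, ← abs_sign_mul i.2, mul_add, mul_left_comm, sign_mul_sign]
    exact le_trans (by omega) (neg_le_abs _)
  have htr : ∀ i : Idx, (N : ℤ) < |transv i| → u i = 0 := fun i hi => by
    refine (tsum_congr fun n : ℕ => ?_).trans tsum_zero
    rw [hfN _ (Or.inr ?_), mul_zero]
    have e := transv_add_step i (-((n : ℤ) + 1))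
    rw [neg_smul, ← sub_eq_add_neg] at e
    rw [e]
    exact hi.le
  -- Beyond the box S u = f + l u has f = 0, so zeros at `sign * long = N`, supplied by the flux
  -- identity, are carried outward step by step.
  have hout : ∀ n : ℕ, ∀ i : Idx, i.2.sign * long i = N + n → u i = 0 := by
    intro n
    induction n with
    | zero => exact fun i hi => outgoing_eq_zero hl hu N hin htr i (by simpa using hi)
    | succ n ih =>
      intro i hi
      have e := long_add_step i (-1)
      have e2 : i.2.sign * long (i.1 + (-1 : ℤ) • i.2.step, i.2) = N + n := by
        rw [e, mul_add, hi, mul_left_comm, sign_mul_sign]; push_cast; ring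
      have h1 := congrFun hshift (i.1 + (-1 : ℤ) • i.2.step, i.2)
      change u (i.1 + (-1 : ℤ) • i.2.step + i.2.step, i.2) = _ at h1
      rw [neg_one_smul, neg_add_cancel_right] at h1
      rw [neg_one_smul] at e2
      rw [show i = (i.1, i.2) from rfl, h1, Pi.add_apply, Pi.smul_apply, ih (_, _) e2, smul_zero,
        add_zero]
      refine hfN _ (Or.inl ?_)
      rw [← abs_sign_mul i.2]
      exact le_trans (by omega) (le_abs_self _)
  have hl0 : l ≠ 0 := by rintro rfl; simp at hl
  have hu0 : u = 0 := by
    refine eq_zero_of_finite_support hl0 hu N fun i hi => ?_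
    rcases abs_coord_cases N i hi with h | h
    · by_cases h2 : i.2.sign * long i ≤ -N
      · exact hin i h2
      · refine hout (i.2.sign * long i - N).toNat i ?_
        rw [← abs_sign_mul i.2] at h
        rcases lt_abs.1 h with h | h <;> omega
    · exact htr i h
  simpa [hu0] using hf

/-! ### Reduction to a finite matrix -/

/-- A finite set supporting all sequences `V u`. -/
def pertSupp (C : Coin) : Finset Idx := (pert_support C).choose

theorem pert_of_notMem {C : Coin} {i : Idx} (hi : i ∉ pertSupp C) (u : Seq) : pert C u i = 0 :=
  (pert_support C).choose_spec u i hi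

/-- Extension by zero from the support of `V`. -/
def extend {C : Coin} (h : pertSupp C → ℂ) : SpaceB := ∑ j, h j • delta j

theorem seq_extend {C : Coin} (h : pertSupp C → ℂ) (f : Seq) (hf : ∀ j : pertSupp C, h j = f j)
    (h0 : ∀ i ∉ pertSupp C, f i = 0) : (extend h).seq = f := by
  rw [← eq_sum_delta (pertSupp C) f h0, extend]
  congr 1
  simp_rw [hf]
  exact Finset.sum_coe_sort (pertSupp C) fun i => f i • delta i

theorem seq_extend_mem {C : Coin} (h : pertSupp C → ℂ) (i : pertSupp C) :
    (extend h).seq i = h i := by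
  classical
  rw [seq_extend h (fun i => if hi : i ∈ pertSupp C then h ⟨i, hi⟩ else 0)]
  · simp
  · simp
  · intro i hi; simp [hi]

theorem seq_extend_notMem {C : Coin} (h : pertSupp C → ℂ) {i : Idx} (hi : i ∉ pertSupp C) :
    (extend h).seq i = 0 := by
  classical
  rw [seq_extend h (fun i => if hi : i ∈ pertSupp C then h ⟨i, hi⟩ else 0)]
  · simp [hi]
  · simp
  · intro i hi; simp [hi]

/-- The operator `V R₀(z)` on `𝓑`. -/
def pertFree (C : Coin) (z : ℂ) (hz : ‖z‖ ≤ 1) : SpaceB →L[ℂ] SpaceB :=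
  pertBsB C ∘L freeResB z hz

theorem seq_pertFree (C : Coin) (z : ℂ) (hz : ‖z‖ ≤ 1) (f : SpaceB) :
    (pertFree C z hz f).seq = pert C (freeRes z f.seq) := rfl

/-- The matrix of `1 + V R₀(z)` on the sequences supported in the support of `V`. -/
def resMatrix (C : Coin) (z : ℂ) : Matrix (pertSupp C) (pertSupp C) ℂ :=
  1 + Matrix.of fun i j : pertSupp C => pert C (freeRes z (delta j).seq) i

/-- The restriction of `V R₀(z) f` to the support of `V`. -/
def resVec (C : Coin) (z : ℂ) (f : SpaceB) : pertSupp C → ℂ :=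
  fun i => pert C (freeRes z f.seq) i

theorem resMatrix_mulVec (C : Coin) {z : ℂ} (hz : ‖z‖ ≤ 1) (h : pertSupp C → ℂ) :
    (resMatrix C z).mulVec h = h + resVec C z (extend h) := by
  funext i
  rw [resMatrix, Matrix.add_mulVec, Matrix.one_mulVec, Pi.add_apply, Pi.add_apply, resVec,
    ← seq_pertFree C z hz, extend]
  simp only [map_sum, map_smul, Finset.sum_apply, Pi.smul_apply, smul_eq_mul, Matrix.mulVec,
    dotProduct, Matrix.of_apply, seq_pertFree]
  congr 1
  exact Finset.sum_congr rfl fun j _ => mul_comm _ _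

/-- The matrix equation is the identity on the support of V; elsewhere every term vanishes. Thus a
finite system solves an equation in 𝓑. -/
theorem extend_add_pertFree (C : Coin) {z : ℂ} (hz : ‖z‖ ≤ 1) (h : pertSupp C → ℂ) (f : SpaceB)
    (hA : (resMatrix C z).mulVec h = resVec C z f) :
    extend h + pertFree C z hz (extend h) = pertFree C z hz f := by
  refine SpaceB.ext (funext fun i => ?_)
  rw [map_add, Pi.add_apply]
  by_cases hi : i ∈ pertSupp C
  · rw [resMatrix_mulVec C hz] at hA
    have h1 := congrFun hA ⟨i, hi⟩
    rw [seq_extend_mem h ⟨i, hi⟩]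
    exact h1
  · rw [seq_extend_notMem h hi, seq_pertFree, seq_pertFree, pert_of_notMem hi, pert_of_notMem hi,
      add_zero]

/-- A kernel vector of the matrix, extended by zero, would be a nonzero solution of f + V R₀(l) f =
0. -/
theorem det_resMatrix_ne_zero (C : Coin) {l : ℂ} (hl : ‖l‖ = 1) : (resMatrix C l).det ≠ 0 := by
  intro h0
  obtain ⟨v, hv, hv0⟩ := Matrix.exists_mulVec_eq_zero_iff.2 h0
  refine hv (funext fun i => ?_)
  have h1 := extend_add_pertFree C hl.le v 0 (by
    rw [hv0]
    funext i
    rw [resVec, ← seq_pertFree C l hl.le, map_zero]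
    simp)
  rw [map_zero] at h1
  have h2 := eq_zero_of_add_pert C hl (extend v) (congrArg SpaceB.seq h1)
  rw [← seq_extend_mem v i, h2]
  rfl

/-- Evaluation at `(x, p)` on `𝓑`. -/
def SpaceB.eval (i : Idx) : SpaceB →L[ℂ] ℂ :=
  LinearMap.mkContinuous (LinearMap.proj i ∘ₗ SpaceB.seq) 1 fun f => by
    have h := ENNReal.toReal_mono f.lt_top.ne (enorm_le_normB f.seq i)
    rw [toReal_enorm] at h
    rw [one_mul]
    exact h

/-- The operator `V R(l)` on `𝓑`, where `R(l) = (U - l)⁻¹` and `l` is on the unit circle. -/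
def pertRes (C : Coin) (l : ℂ) (hl : ‖l‖ ≤ 1) : SpaceB →L[ℂ] SpaceB :=
  ∑ i : pertSupp C, (∑ j : pertSupp C,
    (resMatrix C l)⁻¹ i j • (SpaceB.eval j ∘L pertFree C l hl)).smulRight (delta i)

theorem pertRes_apply (C : Coin) (l : ℂ) (hl : ‖l‖ ≤ 1) (f : SpaceB) :
    pertRes C l hl f = extend ((resMatrix C l)⁻¹.mulVec (resVec C l f)) := by
  simp only [pertRes, _root_.sum_apply, ContinuousLinearMap.smulRight_apply, extend]
  rfl

theorem pertRes_add (C : Coin) {l : ℂ} (hl : ‖l‖ = 1) (f : SpaceB) :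
    pertRes C l hl.le f + pertFree C l hl.le (pertRes C l hl.le f) = pertFree C l hl.le f := by
  rw [pertRes_apply]
  refine extend_add_pertFree C hl.le _ f ?_
  rw [Matrix.mulVec_mulVec, Matrix.mul_nonsing_inv _ (det_resMatrix_ne_zero C hl).isUnit,
    Matrix.one_mulVec]

/-- The operator `1 + V R₀(l)` on `𝓑`. -/
def waveB (C : Coin) (l : ℂ) (hl : ‖l‖ ≤ 1) : SpaceB →L[ℂ] SpaceB :=
  ContinuousLinearMap.id ℂ SpaceB + pertFree C l hl

/-- With K = V R₀(l) and g = `pertRes` f, the relation g + K g = K f gives (1 + K)(f - g) = f. The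
left inverse property then follows from injectivity. -/
theorem waveB_comp (C : Coin) {l : ℂ} (hl : ‖l‖ = 1) (f : SpaceB) :
    waveB C l hl.le ((ContinuousLinearMap.id ℂ SpaceB - pertRes C l hl.le) f) = f := by
  have h := pertRes_add C hl f
  simp only [waveB, _root_.add_apply, _root_.sub_apply,
    ContinuousLinearMap.id_apply, map_sub]
  rw [← h]
  abel

theorem waveB_injective (C : Coin) {l : ℂ} (hl : ‖l‖ = 1) :
    Function.Injective (waveB C l hl.le) := by
  rw [injective_iff_map_eq_zero]
  intro f hf
  refine SpaceB.ext ?_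
  rw [map_zero]
  exact eq_zero_of_add_pert C hl f (congrArg SpaceB.seq hf)

theorem comp_waveB (C : Coin) {l : ℂ} (hl : ‖l‖ = 1) (f : SpaceB) :
    (ContinuousLinearMap.id ℂ SpaceB - pertRes C l hl.le) (waveB C l hl.le f) = f :=
  waveB_injective C hl (waveB_comp C hl _)

/-- The operator `R(l) = R₀(l) (1 - V R(l))` from `𝓑` to `𝓑*`. -/
def resB (C : Coin) (l : ℂ) (hl : ‖l‖ ≤ 1) : SpaceB →L[ℂ] SpaceBs :=
  freeResB l hl ∘L (ContinuousLinearMap.id ℂ SpaceB - pertRes C l hl)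

theorem pertBsB_resB (C : Coin) {l : ℂ} (hl : ‖l‖ = 1) (f : SpaceB) :
    pertBsB C (resB C l hl.le f) = pertRes C l hl.le f := by
  have h := pertRes_add C hl f
  change pertFree C l hl.le (f - pertRes C l hl.le f) = _
  rw [map_sub, ← h]
  abel

/-! ### The resolvent on `ℓ²` -/

/-- The preimage is C* S⁻¹ ψ. Together with norm preservation this makes U unitary on ℓ², so its
spectrum lies on the unit circle. -/
theorem evol_surjective (C : Coin) (ψ : Seq) : ∃ u, evol C u = ψ := by
  refine ⟨fun i => ((C.mat i.1).conjTranspose.mulVec fun q => ψ (i.1 - q.step, q)) i.2,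
    funext fun i => ?_⟩
  change ((C.mat (i.1 + i.2.step)).mulVec ((C.mat (i.1 + i.2.step)).conjTranspose.mulVec
    fun q => ψ (i.1 + i.2.step - q.step, q))) i.2 = _
  rw [Matrix.mulVec_mulVec, ← Matrix.star_eq_conjTranspose,
    (Matrix.mem_unitaryGroup_iff).1 (C.mem_unitary _), Matrix.one_mulVec, add_sub_cancel_right]

theorem evolL2_mem_unitary (C : Coin) : evolL2 C ∈ unitary (L2 →L[ℂ] L2) := by
  have hn : ∀ ψ, ‖evolL2 C ψ‖ = ‖ψ‖ := fun ψ => by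
    have : ‖evolL2 C ψ‖ₑ = ‖ψ‖ₑ := by
      rw [enorm_lp, enorm_lp]; exact l2_evol C ψ
    simpa [enorm_eq_iff_norm_eq] using this
  have hs : Function.Surjective (evolL2 C) := fun ψ => by
    obtain ⟨u, hu⟩ := evol_surjective C ψ
    have hmem : Memℓp u 2 := by
      rw [memℓp_iff_l2, ← l2_evol C, hu]
      exact (memℓp_iff_l2 _).1 (lp.memℓp ψ)
    exact ⟨⟨u, hmem⟩, Subtype.ext hu⟩
  let e : L2 ≃ₗᵢ[ℂ] L2 :=
    LinearIsometryEquiv.ofSurjective ⟨(evolL2 C).toLinearMap, hn⟩ hs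
  exact (Unitary.linearIsometryEquiv.symm e).2

theorem isUnit_evolL2_sub (C : Coin) {z : ℂ} (hz : ‖z‖ < 1) :
    IsUnit (evolL2 C - z • (1 : L2 →L[ℂ] L2)) := by
  have h : z ∉ spectrum ℂ (evolL2 C) := fun h => by
    have h2 := spectrum.subset_circle_of_unitary (evolL2_mem_unitary C) h
    rw [mem_sphere_zero_iff_norm] at h2
    exact hz.ne h2
  rw [spectrum.notMem_iff, Algebra.algebraMap_eq_smul_one] at h
  rw [← neg_sub]
  exact h.neg

theorem evol_resolventL2 (C : Coin) {κ : ℂ} (hκ : ‖Complex.exp (Complex.I * κ)‖ < 1) (f : L2) :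
    evol C (resolventL2 C κ f) = f + Complex.exp (Complex.I * κ) • (resolventL2 C κ f : Seq) := by
  have h := Ring.mul_inverse_cancel _ (isUnit_evolL2_sub C hκ)
  have h2 := congrArg (fun T : L2 →L[ℂ] L2 => (T f : Seq)) h
  exact sub_eq_iff_eq_add.1 h2

/-- A sequence which is bounded on lines and satisfies `S v = z v`, `|z| < 1`, vanishes. -/
theorem eq_zero_of_shift_eq {z : ℂ} (hz : ‖z‖ < 1) {v : Seq} (hv : shift v = z • v)
    (hb : ∀ i : Idx, ∃ M : ℝ, ∀ m : ℕ, ‖v (i.1 - (m : ℤ) • i.2.step, i.2)‖ ≤ M) : v = 0 := by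
  funext i
  obtain ⟨M, hM⟩ := hb i
  -- Iterating S v = z v backwards along the line gains a factor z^m, which beats the bound M.
  have h : ∀ m : ℕ, v i = z ^ m * v (i.1 - (m : ℤ) • i.2.step, i.2) := by
    intro m
    induction m with
    | zero => simp
    | succ m ih =>
      have h1 := congrFun hv (i.1 - ((m + 1 : ℕ) : ℤ) • i.2.step, i.2)
      change v (i.1 - ((m + 1 : ℕ) : ℤ) • i.2.step + i.2.step, i.2) = z * _ at h1
      rw [Nat.cast_succ, add_smul, one_smul, ← sub_sub, sub_add_cancel] at h1
      rw [ih, h1, pow_succ, Nat.cast_succ, add_smul, one_smul, ← sub_sub, mul_assoc]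
  have hlim : Filter.Tendsto (fun m : ℕ => ‖z‖ ^ m * M) Filter.atTop (nhds (0 * M)) :=
    (tendsto_pow_atTop_nhds_zero_of_lt_one (norm_nonneg _) hz).mul_const M
  rw [zero_mul] at hlim
  have h3 : ‖v i‖ ≤ 0 := ge_of_tendsto' hlim fun m => by
    rw [h m, norm_mul, norm_pow]
    gcongr
    exact hM m
  simpa using h3

/-- The resolvent equation `R(z) = R₀(z) (1 - V R(z))` inside the unit disc. -/
theorem eq_freeRes_of_evol (C : Coin) {z : ℂ} (hz : ‖z‖ < 1) (f : SpaceB) (u : L2)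
    (hu : evol C u = f.seq + z • (u : Seq)) :
    (u : Seq) = freeRes z (f - extend fun j : pertSupp C => pert C u j).seq := by
  set k := f - extend fun j : pertSupp C => pert C u j with hk
  have hkseq : k.seq = f.seq - pert C u := by
    rw [hk, map_sub, seq_extend _ (pert C u) (fun _ => rfl) fun i hi => pert_of_notMem hi u]
  refine sub_eq_zero.1 (eq_zero_of_shift_eq hz ?_ fun i => ?_)
  -- Both sides solve (S - z) w = f - V u, so their difference is a solution of the homogeneous
  -- equation.
  · have h : shift (u : Seq) = evol C u - pert C u := by simp [pert]
    rw [map_sub, shift_freeRes hz.le, h, hu, hkseq, smul_sub]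
    abel
  -- The ℓ² norm bounds all values of u, and the line sum, which depends only on the line, bounds
  -- the free resolvent.
  · refine ⟨‖u‖ + (lineSum k.seq (i.2, transv i)).toReal, fun m => ?_⟩
    refine (norm_sub_le _ _).trans (add_le_add (lp.norm_apply_le_norm (by simp) u _) ?_)
    have h := enorm_freeRes_le hz.le k.seq (i.1 + (-(m : ℤ)) • i.2.step, i.2)
    rw [transv_add_step, neg_smul, ← sub_eq_add_neg] at h
    have h2 := ENNReal.toReal_mono (lineSum_lt_top k _).ne h
    rwa [toReal_enorm] at h2

/-- Applying V to u = R₀(z)(f - V u) gives (1 + V R₀(z)) V u = V R₀(z) f, a closed finite system for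
V u. -/
theorem resMatrix_mulVec_pert (C : Coin) {z : ℂ} (hz : ‖z‖ < 1) (f : SpaceB) (u : L2)
    (hu : evol C u = f.seq + z • (u : Seq)) :
    (resMatrix C z).mulVec (fun j => pert C u j) = resVec C z f := by
  rw [resMatrix_mulVec C hz.le]
  funext i
  have h := eq_freeRes_of_evol C hz f u hu
  have h2 : pert C u i = (pertFree C z hz.le
      (f - extend fun j : pertSupp C => pert C u j)).seq i := by
    rw [seq_pertFree, ← h]
  rw [map_sub, map_sub] at h2
  change pert C u i + (pertFree C z hz.le (extend fun j : pertSupp C => pert C u j)).seq i =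
    (pertFree C z hz.le f).seq i
  rw [h2, Pi.sub_apply]
  ring

/-! ### The limiting absorption principle -/

/-- The pairing with `g ∈ 𝓑` as a linear functional on `𝓑*`. -/
def pairingL (g : SpaceB) : SpaceBs →ₗ[ℂ] ℂ where
  toFun u := pairing u.seq g.seq
  map_add' u v := by
    have h : ∀ u : SpaceBs, Summable fun i => u.seq i * (starRingEnd ℂ) (g.seq i) := fun u =>
      Summable.of_norm_bounded (summable_pairing u g) fun i => by simp
    simp only [pairing, map_add, Pi.add_apply, add_mul]
    exact (h u).tsum_add (h v)
  map_smul' c u := by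
    simp only [pairing, map_smul, Pi.smul_apply, smul_eq_mul, mul_assoc, RingHom.id_apply]
    exact tsum_mul_left

theorem pairingL_extend (g : SpaceB) {C : Coin} {z : ℂ} (hz : ‖z‖ ≤ 1) (f : SpaceB)
    (h : pertSupp C → ℂ) : pairing (freeRes z (f - extend h).seq) g.seq =
      pairing (freeRes z f.seq) g.seq - ∑ j, h j * pairing (freeRes z (delta j).seq) g.seq := by
  change pairingL g (freeResB z hz (f - extend h)) = pairingL g (freeResB z hz f) -
    ∑ j, h j * pairingL g (freeResB z hz (delta j))
  simp [extend, map_sub, map_sum, map_smul]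

section Limit

variable {ι : Type} {l : Filter ι} {z : ι → ℂ} {w : ℂ}

theorem tendsto_pairing_freeRes (hz : ∀ᶠ t in l, ‖z t‖ ≤ 1) (h : Filter.Tendsto z l (nhds w))
    (f g : SpaceB) : Filter.Tendsto (fun t => pairing (freeRes (z t) f.seq) g.seq) l
      (nhds (pairing (freeRes w f.seq) g.seq)) := by
  -- The dominating sequence, constant along lines, belongs to 𝓑* and is therefore summable against
  -- g.
  have hL : normBs (fun i => ((lineSum f.seq (i.2, transv i)).toReal : ℂ)) < ∞ := by
    refine (normBs_le_of_line (c := lineSum f.seq) fun i => ?_).trans_lt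
      (ENNReal.mul_lt_top sqrt_two_lt_top ((l2_line_le f.seq).trans_lt
        (ENNReal.mul_lt_top sqrt_two_lt_top f.lt_top)))
    rw [← ofReal_norm, Complex.norm_real, Real.norm_of_nonneg ENNReal.toReal_nonneg]
    exact ENNReal.ofReal_toReal_le
  refine tendsto_tsum_of_dominated_convergence (summable_pairing (SpaceBs.mk _ hL) g)
    (fun i => (tendsto_freeRes hz h f i).mul_const _) ?_
  filter_upwards [hz] with t ht i
  rw [norm_mul, RCLike.norm_conj, SpaceBs.seq_mk, Complex.norm_real,
    Real.norm_of_nonneg ENNReal.toReal_nonneg]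
  gcongr
  have h2 := ENNReal.toReal_mono (lineSum_lt_top f _).ne (enorm_freeRes_le ht f.seq i)
  rwa [toReal_enorm] at h2

theorem tendsto_pert_freeRes (C : Coin) (hz : ∀ᶠ t in l, ‖z t‖ ≤ 1)
    (h : Filter.Tendsto z l (nhds w)) (f : SpaceB) (i : Idx) :
    Filter.Tendsto (fun t => pert C (freeRes (z t) f.seq) i) l
      (nhds (pert C (freeRes w f.seq) i)) := by
  have h1 : Filter.Tendsto (fun t => ∑ q, C.mat (i.1 + i.2.step) i.2 q *
      freeRes (z t) f.seq (i.1 + i.2.step, q)) l (nhds (∑ q, C.mat (i.1 + i.2.step) i.2 q *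
      freeRes w f.seq (i.1 + i.2.step, q))) :=
    tendsto_finsetSum _ fun q _ => (tendsto_freeRes hz h f _).const_mul _
  exact h1.sub (tendsto_freeRes hz h f (i.1 + i.2.step, i.2))

theorem tendsto_resMatrix (C : Coin) (hz : ∀ᶠ t in l, ‖z t‖ ≤ 1)
    (h : Filter.Tendsto z l (nhds w)) :
    Filter.Tendsto (fun t => resMatrix C (z t)) l (nhds (resMatrix C w)) := by
  have h1 : Filter.Tendsto (fun t => (Matrix.of fun i j : pertSupp C =>
      pert C (freeRes (z t) (delta j).seq) i)) l
      (nhds (Matrix.of fun i j : pertSupp C => pert C (freeRes w (delta j).seq) i)) :=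
    tendsto_pi_nhds.2 fun i => tendsto_pi_nhds.2 fun j => tendsto_pert_freeRes C hz h (delta j) i
  exact h1.const_add 1

theorem tendsto_resMatrix_inv (C : Coin) (hw : ‖w‖ = 1) (hz : ∀ᶠ t in l, ‖z t‖ ≤ 1)
    (h : Filter.Tendsto z l (nhds w)) :
    Filter.Tendsto (fun t => (resMatrix C (z t))⁻¹) l (nhds (resMatrix C w)⁻¹) := by
  have hA := tendsto_resMatrix C hz h
  simp only [Matrix.inv_def, Ring.inverse_eq_inv']
  refine Filter.Tendsto.smul (Filter.Tendsto.inv₀ ?_ (det_resMatrix_ne_zero C hw)) ?_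
  · exact (continuous_id.matrix_det.tendsto _).comp hA
  · exact (continuous_id.matrix_adjugate.tendsto _).comp hA

/-- The determinant is nonzero at w, hence eventually nonzero along z; so V u is eventually given by
the inverse matrix, and every ingredient of u = R₀(z)(f - V u) converges when paired with g. -/
theorem tendsto_pairing_solution (C : Coin) (hw : ‖w‖ = 1) (hz : ∀ᶠ t in l, ‖z t‖ < 1)
    (h : Filter.Tendsto z l (nhds w)) (f g : SpaceB) (u : ι → L2)
    (hu : ∀ᶠ t in l, evol C (u t) = f.seq + z t • (u t : Seq)) :
    Filter.Tendsto (fun t => pairing (u t) g.seq) l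
      (nhds (pairing (resB C w hw.le f).seq g.seq)) := by
  have hz' : ∀ᶠ t in l, ‖z t‖ ≤ 1 := hz.mono fun t ht => ht.le
  have hdet : ∀ᶠ t in l, (resMatrix C (z t)).det ≠ 0 :=
    ((continuous_id.matrix_det.tendsto _).comp (tendsto_resMatrix C hz' h)).eventually_ne
      (det_resMatrix_ne_zero C hw)
  have hvec : Filter.Tendsto (fun t => (resMatrix C (z t))⁻¹.mulVec (resVec C (z t) f)) l
      (nhds ((resMatrix C w)⁻¹.mulVec (resVec C w f))) := by
    have hA := tendsto_resMatrix_inv C hw hz' h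
    refine tendsto_pi_nhds.2 fun i => tendsto_finsetSum _ fun j _ => Filter.Tendsto.mul ?_ ?_
    · exact tendsto_pi_nhds.1 (tendsto_pi_nhds.1 hA i) j
    · exact tendsto_pert_freeRes C hz' h f j
  have hR : (resB C w hw.le f).seq =
      freeRes w (f - extend ((resMatrix C w)⁻¹.mulVec (resVec C w f))).seq := by
    rw [← pertRes_apply C w hw.le]; rfl
  rw [hR, pairingL_extend g hw.le]
  have hlim := (tendsto_pairing_freeRes hz' h f g).sub (tendsto_finsetSum Finset.univ fun j _ =>
    (tendsto_pi_nhds.1 hvec j).mul (tendsto_pairing_freeRes hz' h (delta j) g))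
  refine hlim.congr' ?_
  filter_upwards [hz, hdet, hu] with t h1 h2 h3
  rw [← pairingL_extend g h1.le, ← resMatrix_mulVec_pert C h1 f (u t) h3, Matrix.mulVec_mulVec,
    Matrix.nonsing_inv_mul _ h2.isUnit, Matrix.one_mulVec, ← eq_freeRes_of_evol C h1 f (u t) h3]

end Limit

/-! ### Radial approach to the unit circle and uniqueness of the boundary value -/

theorem exp_I_mul (θ : ℝ) {ε : ℝ} (hε : ε < 1) :
    Complex.exp (Complex.I * ((θ : ℂ) - Complex.I * (Real.log (1 - ε) : ℝ))) =
      ((1 - ε : ℝ) : ℂ) * Complex.exp (Complex.I * θ) := by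
  rw [mul_sub, ← mul_assoc, Complex.I_mul_I, neg_one_mul, sub_neg_eq_add, Complex.exp_add,
    ← Complex.ofReal_exp, Real.exp_log (by linarith), mul_comm]

theorem norm_exp_I_mul (θ : ℝ) : ‖Complex.exp (Complex.I * θ)‖ = 1 := by
  rw [mul_comm]; exact Complex.norm_exp_ofReal_mul_I θ

theorem isBoundaryResolvent_resB (C : Coin) (θ : ℝ) :
    IsBoundaryResolvent C θ (resB C _ (norm_exp_I_mul θ).le) := by
  intro f g
  have hε : ∀ᶠ ε : ℝ in nhdsWithin 0 (Set.Ioi 0), 0 < ε ∧ ε < 1 :=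
    Ioo_mem_nhdsGT one_pos
  have hz : ∀ᶠ ε : ℝ in nhdsWithin 0 (Set.Ioi 0), ‖Complex.exp (Complex.I *
      ((θ : ℂ) - Complex.I * (Real.log (1 - ε) : ℝ)))‖ < 1 := by
    filter_upwards [hε] with ε h
    rw [exp_I_mul θ h.2, norm_mul, norm_exp_I_mul, mul_one, Complex.norm_real,
      Real.norm_of_nonneg (by linarith)]
    linarith
  refine tendsto_pairing_solution C (norm_exp_I_mul θ) hz ?_ f g _
    (hz.mono fun ε h => evol_resolventL2 C h f.toL2)
  have h2 : Filter.Tendsto (fun ε : ℝ => ((1 - ε : ℝ) : ℂ) * Complex.exp (Complex.I * θ))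
      (nhdsWithin 0 (Set.Ioi 0)) (nhds (Complex.exp (Complex.I * θ))) := by
    refine Filter.Tendsto.mono_left ?_ nhdsWithin_le_nhds
    refine Continuous.tendsto' (by fun_prop) _ _ (by simp)
  refine h2.congr' ?_
  filter_upwards [hε] with ε h using (exp_I_mul θ h.2).symm

theorem isBoundaryResolvent_boundaryResolvent (C : Coin) (θ : ℝ) :
    IsBoundaryResolvent C θ (boundaryResolvent C θ) := by
  have h : ∃ R, IsBoundaryResolvent C θ R := ⟨_, isBoundaryResolvent_resB C θ⟩
  rw [boundaryResolvent, dif_pos h]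
  exact h.choose_spec

/-- Pairing with the sequences δ recovers every value, so weak-* limits are unique and the chosen
operator is the explicit one. -/
theorem boundaryResolvent_eq (C : Coin) (θ : ℝ) :
    boundaryResolvent C θ = resB C _ (norm_exp_I_mul θ).le := by
  refine ContinuousLinearMap.ext fun f => SpaceBs.ext (funext fun i => ?_)
  have h := tendsto_nhds_unique (isBoundaryResolvent_boundaryResolvent C θ f (delta i))
    (isBoundaryResolvent_resB C θ f (delta i))
  rwa [pairing_delta, pairing_delta] at h

/-! ### The free Fourier transformation -/

theorem sqrt_two_pi_ne_zero : ((Real.sqrt (2 * Real.pi) : ℝ) : ℂ) ≠ 0 :=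
  Complex.ofReal_ne_zero.2 (by positivity)

theorem fourier0_surjective (θ : ℝ) : Function.Surjective (fourier0 θ) := by
  intro φ
  -- Data placed on the axes `long = 0`, which form the shell 0, where the Fourier sum has a single
  -- term with phase 1; √(2π) cancels the normalisation.
  let f : Seq := fun i =>
    if long i = 0 then ((Real.sqrt (2 * Real.pi) : ℝ) : ℂ) * φ (i.2, transv i) else 0
  have hl2 : l2 (fun i => ‖f i‖ₑ) = ‖((Real.sqrt (2 * Real.pi) : ℝ) : ℂ)‖ₑ * ‖φ‖ₑ := by
    rw [enorm_lp, ← l2_const_mul, l2, l2, ← lineEquiv.tsum_eq, ENNReal.tsum_prod' (α := Chir × ℤ)]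
    congr 1
    refine tsum_congr fun k => ?_
    rw [tsum_eq_single 0]
    · simp [f, lineEquiv, long_site, transv_site]
    · intro y hy
      simp [f, lineEquiv, long_site, hy]
  have hf : normB f < ∞ := by
    rw [normB_of_shell 0]
    · refine ENNReal.mul_lt_top (wt_ne_top 0).lt_top ((shellNorm_le_l2 0 f).trans_lt ?_)
      rw [hl2]
      exact ENNReal.mul_lt_top enorm_lt_top enorm_lt_top
    · intro i hi
      refine if_neg fun h => hi ?_
      rw [mem_shell_iff, h]
      rfl
  refine ⟨SpaceB.mk f hf, lp.ext (funext fun k => ?_)⟩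
  change ((1 / Real.sqrt (2 * Real.pi) : ℝ) : ℂ) *
    ∑' y : ℤ, Complex.exp (-(Complex.I * θ * (k.1.sign * y : ℤ))) * f (site k.1 y k.2, k.1) = φ k
  rw [tsum_eq_single 0]
  · simp only [f, long_site, transv_site, if_true, mul_zero, Int.cast_zero, neg_zero,
      Complex.exp_zero, one_mul, Complex.ofReal_div, Complex.ofReal_one]
    field_simp [sqrt_two_pi_ne_zero]
  · intro y hy
    simp [f, long_site, hy]

theorem fourier0_delta (θ : ℝ) (i : Idx) (k : Chir × ℤ) :
    fourier0 θ (delta i) k = if k = (i.2, transv i) then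
      ((1 / Real.sqrt (2 * Real.pi) : ℝ) : ℂ) *
        Complex.exp (-(Complex.I * θ * (i.2.sign * long i : ℤ))) else 0 := by
  change ((1 / Real.sqrt (2 * Real.pi) : ℝ) : ℂ) *
    ∑' y : ℤ, Complex.exp (-(Complex.I * θ * (k.1.sign * y : ℤ))) *
      (Pi.single i 1 : Seq) (site k.1 y k.2, k.1) = _
  have hne : ∀ y, (k, y) ≠ ((i.2, transv i), long i) →
      (Pi.single i 1 : Seq) (site k.1 y k.2, k.1) = 0 := fun y h =>
    Pi.single_eq_of_ne (fun h2 => h (lineEquiv.eq_symm_apply.2 h2)) _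
  split_ifs with hk
  · rw [tsum_eq_single (long i)]
    · subst hk
      have h : ((site i.2 (long i) (transv i), i.2) : Idx) = i :=
        Prod.ext (site_long_transv i) rfl
      simp only [h, Pi.single_eq_same, mul_one]
    · intro y hy
      rw [hne y (by simp [hy]), mul_zero]
  · rw [(tsum_congr fun y => by rw [hne y (by simp [hk]), mul_zero]).trans tsum_zero, mul_zero]

theorem inner_fourier0_delta (θ : ℝ) (φ : SpaceH) (i : Idx) :
    inner ℂ φ (fourier0 θ (delta i)) = ((1 / Real.sqrt (2 * Real.pi) : ℝ) : ℂ) *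
        Complex.exp (-(Complex.I * θ * (i.2.sign * long i : ℤ))) *
          (starRingEnd ℂ) (φ (i.2, transv i)) := by
  rw [lp.inner_eq_tsum, tsum_eq_single (i.2, transv i)]
  · rw [fourier0_delta, if_pos rfl, RCLike.inner_apply]
  · intro k hk
    rw [fourier0_delta, if_neg hk, inner_zero_right]

theorem exp_sign_sub (θ : ℝ) (p : Chir) (y : ℤ) :
    Complex.exp (-(Complex.I * θ * (p.sign * (y - p.sign) : ℤ))) =
      Complex.exp (Complex.I * θ) * Complex.exp (-(Complex.I * θ * (p.sign * y : ℤ))) := by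
  rw [mul_sub, sign_mul_sign, ← Complex.exp_add]
  congr 1
  push_cast
  ring

theorem long_sub_step (i : Idx) : long (i.1 - i.2.step, i.2) = long i - i.2.sign := by
  have h := long_add_step i (-1)
  rwa [neg_one_smul, neg_one_mul, ← sub_eq_add_neg, ← sub_eq_add_neg] at h

theorem transv_sub_step (i : Idx) : transv (i.1 - i.2.step, i.2) = transv i := by
  have h := transv_add_step i (-1)
  rwa [neg_one_smul, ← sub_eq_add_neg] at h

/-- `S δ_{(x, p)} - l δ_{(x, p)}`. -/
def shiftDelta (l : ℂ) (i : Idx) : SpaceB := delta (i.1 - i.2.step, i.2) - l • delta i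

/-- On the transform side S is multiplication by e^{iθ}. -/
theorem fourier0_shiftDelta (θ : ℝ) (i : Idx) :
    fourier0 θ (shiftDelta (Complex.exp (Complex.I * θ)) i) = 0 := by
  refine lp.ext (funext fun k => ?_)
  rw [shiftDelta, map_sub, map_smul]
  change fourier0 θ (delta (i.1 - i.2.step, i.2)) k - _ * fourier0 θ (delta i) k = 0
  rw [fourier0_delta, fourier0_delta, transv_sub_step, long_sub_step]
  split_ifs
  · rw [exp_sign_sub]; ring
  · simp

/-! ### Generalized eigenfunctions -/

/-- `U δ_{(x, p)}` as an element of `𝓑`. -/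
def evolDelta (C : Coin) (i : Idx) : SpaceB := ∑ q, C.mat i.1 q i.2 • delta (i.1 - q.step, q)

theorem single_step (i k : Idx) (q : Chir) :
    (Pi.single i 1 : Seq) (k.1 + k.2.step, q) =
      if k.1 = i.1 - k.2.step ∧ q = i.2 then 1 else 0 := by
  rw [Pi.single_apply]
  refine if_congr ?_ rfl rfl
  rw [Prod.ext_iff, eq_sub_iff_add_eq]

theorem seq_evolDelta (C : Coin) (i : Idx) : (evolDelta C i).seq = evol C (delta i).seq := by
  funext k
  rw [evolDelta, map_sum, Finset.sum_apply]
  change ∑ q, C.mat i.1 q i.2 * (Pi.single (i.1 - q.step, q) 1 : Seq) k =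
    ∑ q, C.mat (k.1 + k.2.step) k.2 q * (Pi.single i 1 : Seq) (k.1 + k.2.step, q)
  simp only [single_step]
  rw [Finset.sum_eq_single k.2, Finset.sum_eq_single i.2]
  · rw [Pi.single_apply]
    obtain ⟨x, p⟩ := k
    by_cases h : x = i.1 - p.step
    · subst h; simp
    · simp [h]
  · intro q _ hq; simp [hq]
  · simp
  · intro q _ hq
    rw [Pi.single_eq_of_ne, mul_zero]
    exact fun h => hq (congrArg Prod.snd h).symm
  · simp

theorem seq_delta_step (i : Idx) :
    (delta (i.1 - i.2.step, i.2)).seq = shift (delta i).seq := by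
  funext k
  change (Pi.single (i.1 - i.2.step, i.2) 1 : Seq) k =
    (Pi.single i 1 : Seq) (k.1 + k.2.step, k.2)
  rw [single_step, Pi.single_apply]
  refine if_congr ?_ rfl rfl
  rw [Prod.ext_iff]
  constructor <;> rintro ⟨h1, h2⟩ <;> simp_all

/-- Since R₀(l)(S - l) δ = δ, the term V R₀(l) contributes V δ, and S + V = U. -/
theorem waveB_shiftDelta (C : Coin) {l : ℂ} (hl : ‖l‖ ≤ 1) (i : Idx) :
    waveB C l hl (shiftDelta l i) = evolDelta C i - l • delta i := by
  have h1 : (freeResB l hl (shiftDelta l i)).seq = (delta i).seq := by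
    rw [shiftDelta, map_sub, map_smul, map_sub, map_smul, seq_freeResB, seq_freeResB,
      seq_delta_step, freeRes_shift hl]
    abel
  have h2 : (pertFree C l hl (shiftDelta l i)).seq = pert C (delta i).seq :=
    congrArg (pert C) h1
  refine SpaceB.ext ?_
  change (shiftDelta l i).seq + (pertFree C l hl (shiftDelta l i)).seq = _
  rw [h2, shiftDelta, map_sub, map_sub, seq_evolDelta, seq_delta_step, pert,
    LinearMap.sub_apply]
  abel

/-- `u` is a generalized eigenfunction of `U` if and only if the functional represented by `u`
vanishes on the sequences `(U - l) δ_{(x, p)}`. -/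
theorem evol_eq_iff (C : Coin) {l : ℂ} (hl : ‖l‖ = 1) (u : Seq) (a : SpaceB →L[ℂ] ℂ)
    (ha : ∀ i, a (delta i) = (starRingEnd ℂ) (u i)) :
    evol C u = l • u ↔ ∀ i, a (evolDelta C i - l • delta i) = 0 := by
  have hll : l * (starRingEnd ℂ) l = 1 := by
    rw [Complex.mul_conj, Complex.normSq_eq_norm_sq, hl]; simp
  have hL : evol C u = l • u ↔ ∀ x, (C.mat x).mulVec (fun q => u (x, q)) =
      l • fun q => u (x - q.step, q) := by
    constructor
    · exact fun hu x => funext fun p => coin_mul_of_evol hu x p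
    · intro h
      funext i
      have h2 := congrFun (h (i.1 + i.2.step)) i.2
      rw [Pi.smul_apply, add_sub_cancel_right] at h2
      exact h2
  -- Conjugating the functional turns U δ into the adjoint coin. What remains is that C v = l w and
  -- C* w = l̄ v are equivalent for unitary C and |l| = 1.
  have hR : (∀ i, a (evolDelta C i - l • delta i) = 0) ↔ ∀ x,
      (star (C.mat x)).mulVec (fun q => u (x - q.step, q)) =
        (starRingEnd ℂ) l • fun q => u (x, q) := by
    have h1 : ∀ i, a (evolDelta C i - l • delta i) = 0 ↔
        (star (C.mat i.1)).mulVec (fun q => u (i.1 - q.step, q)) i.2 =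
          (starRingEnd ℂ) l * u i := fun i => by
      rw [map_sub, evolDelta, map_sum, sub_eq_zero,
        ← (starRingEnd ℂ).injective.eq_iff]
      simp only [map_smul, ha, smul_eq_mul, map_sum, map_mul, Complex.conj_conj]
      rfl
    constructor
    · exact fun h x => funext fun p => (h1 (x, p)).1 (h (x, p))
    · exact fun h i => (h1 i).2 (congrFun (h i.1) i.2)
  rw [hL, hR]
  refine forall_congr' fun x => ⟨fun h => ?_, fun h => ?_⟩
  · have h2 := congrArg (star (C.mat x)).mulVec h
    rw [Matrix.mulVec_mulVec, (Matrix.mem_unitaryGroup_iff').1 (C.mem_unitary x),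
      Matrix.one_mulVec, Matrix.mulVec_smul] at h2
    rw [h2, smul_smul, mul_comm, hll, one_smul]
  · have h2 := congrArg (C.mat x).mulVec h
    rw [Matrix.mulVec_mulVec, (Matrix.mem_unitaryGroup_iff).1 (C.mem_unitary x),
      Matrix.one_mulVec, Matrix.mulVec_smul] at h2
    rw [h2, smul_smul, hll, one_smul]

/-- The functional `f ↦ ⟨φ, T f⟩` represented by `T* φ`. -/
def adjointFunctional (T : SpaceB →L[ℂ] SpaceH) (φ : SpaceH) : SpaceB →L[ℂ] ℂ :=
  innerSL ℂ φ ∘L T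

theorem adjointFunctional_delta (T : SpaceB →L[ℂ] SpaceH) (φ : SpaceH) (i : Idx) :
    adjointFunctional T φ (delta i) = (starRingEnd ℂ) ((adjoint T φ).seq i) :=
  (inner_conj_symm φ (T (delta i))).symm

/-- The values of a bounded functional on `𝓑` at the sequences `δ_{(x, p)}` with `(x, p)` on the
axes are square summable. -/
theorem memℓp_functional_axis (a : SpaceB →L[ℂ] ℂ) (c : ℂ) :
    Memℓp (fun k : Chir × ℤ => c * (starRingEnd ℂ) (a (delta (site k.1 0 k.2, k.1)))) 2 := by
  -- Tensoring a with a unit vector makes it an operator into h(θ), so that the norm bound behind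
  -- `adjoint` represents a by an element of 𝓑*; its part on shell 0 is the required ℓ² family.
  let e : SpaceH := lp.single 2 (Chir.left, (0 : ℤ)) (1 : ℂ)
  have he : inner ℂ e e = (1 : ℂ) := by
    rw [inner_self_eq_norm_sq_to_K, lp.norm_single (by norm_num)]; simp
  let v : SpaceBs := adjoint (a.smulRight e) e
  have hv : ∀ i, v.seq i = (starRingEnd ℂ) (a (delta i)) := fun i => by
    change inner ℂ (a (delta i) • e) e = _
    rw [inner_smul_left, he, mul_one]
  rw [memℓp_iff_l2]
  simp_rw [← hv, enorm_mul]
  rw [l2_const_mul]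
  refine ENNReal.mul_ne_top enorm_ne_top (ne_top_of_le_ne_top
    (ENNReal.mul_ne_top (wt_ne_top 0) v.lt_top.ne) (le_trans ?_ (shellNorm_le_normBs v.seq 0)))
  rw [shellNorm, l2_le_iff, l2_sq]
  have hmem : ∀ k : Chir × ℤ, ((site k.1 0 k.2, k.1) : Idx) ∈ shell 0 := fun k => by
    rw [mem_shell_iff, long_site]; rfl
  refine ENNReal.tsum_comp_le_tsum_of_injective
    (f := fun k : Chir × ℤ => (⟨(site k.1 0 k.2, k.1), hmem k⟩ : shell 0)) (fun k k' h => ?_)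
    (fun i => ‖v.seq i‖ₑ ^ 2)
  have h2 := site_injective (a₁ := (k, 0)) (a₂ := (k', 0)) (congrArg Subtype.val h)
  exact congrArg Prod.fst h2

/-- Bounded functionals on `𝓑` vanishing on `(S - e^{iθ}) δ_{(x, p)}` are represented by
`𝓕⁽⁰⁾(θ)* φ`. -/
theorem exists_adjointFunctional_eq (θ : ℝ) (a : SpaceB →L[ℂ] ℂ)
    (ha : ∀ i, a (shiftDelta (Complex.exp (Complex.I * θ)) i) = 0) :
    ∃ φ : SpaceH, ∀ f, adjointFunctional (fourier0 θ) φ f = a f := by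
  have hstep : ∀ i, a (delta (i.1 - i.2.step, i.2)) =
      Complex.exp (Complex.I * θ) * a (delta i) := fun i => by
    have h := ha i
    rwa [shiftDelta, map_sub, map_smul, sub_eq_zero] at h
  have hline : ∀ (p : Chir) (z y : ℤ), a (delta (site p y z, p)) =
      Complex.exp (-(Complex.I * θ * (p.sign * y : ℤ))) * a (delta (site p 0 z, p)) := by
    intro p z
    -- Removing the plane wave phase makes the values invariant under steps along the line, hence
    -- constant.
    let g : ℤ → ℂ := fun y =>
      Complex.exp (Complex.I * θ * (p.sign * y : ℤ)) * a (delta (site p y z, p))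
    have hg : ∀ y, g (y - p.sign) = g y := fun y => by
      have h := hstep (site p y z, p)
      have e := site_add_step p y z (-1)
      rw [neg_one_smul, ← sub_eq_add_neg, neg_one_mul, ← sub_eq_add_neg] at e
      dsimp only at h
      rw [e] at h
      simp only [g]
      rw [h, ← mul_assoc, ← Complex.exp_add, mul_sub, sign_mul_sign]
      congr 2
      push_cast
      ring
    have hg1 : ∀ y, g (y + 1) = g y := fun y => by
      cases p
      · simpa [Chir.sign] using (hg (y + 1)).symm
      · simpa [Chir.sign] using hg y
      · simpa [Chir.sign] using (hg (y + 1)).symm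
      · simpa [Chir.sign] using hg y
    have hconst : ∀ y, g y = g 0 := fun y => by
      induction y using Int.induction_on with
      | zero => rfl
      | succ n ih => rw [hg1, ih]
      | pred n ih => rw [← ih, ← hg1, sub_add_cancel]
    intro y
    have h := hconst y
    simp only [g, mul_zero, Int.cast_zero, Complex.exp_zero, one_mul] at h
    rw [← h, ← mul_assoc, ← Complex.exp_add, neg_add_cancel, Complex.exp_zero, one_mul]
  -- φ consists of the conjugate values of a on the axes, with √(2π) compensating the normalisation
  -- of 𝓕⁽⁰⁾; it suffices to compare on the sequences δ.
  refine ⟨⟨_, memℓp_functional_axis a ((Real.sqrt (2 * Real.pi) : ℝ) : ℂ)⟩,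
    functional_ext fun i => ?_⟩
  refine (inner_fourier0_delta θ _ i).trans ?_
  have h2 : ((site i.2 (long i) (transv i), i.2) : Idx) = i := Prod.ext (site_long_transv i) rfl
  conv_rhs => rw [← h2, hline]
  simp only [map_mul, Complex.conj_ofReal, Complex.conj_conj, Complex.ofReal_div,
    Complex.ofReal_one]
  field_simp [sqrt_two_pi_ne_zero]

/-! ### The distorted Fourier transformation: surjectivity and eigenfunctions -/

theorem distortedFourier_apply (C : Coin) (θ : ℝ) (f : SpaceB) :
    distortedFourier C θ f = fourier0 θ
      ((ContinuousLinearMap.id ℂ SpaceB - pertRes C _ (norm_exp_I_mul θ).le) f) := by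
  change fourier0 θ (f - pertBsB C (boundaryResolvent C θ f)) = _
  rw [boundaryResolvent_eq, pertBsB_resB C (norm_exp_I_mul θ)]
  rfl

/-- This is 𝓕⁽⁺⁾ W = 𝓕⁽⁰⁾; it transfers both surjectivity and the eigenfunction property from the
free transform. -/
theorem distortedFourier_waveB (C : Coin) (θ : ℝ) (f : SpaceB) :
    distortedFourier C θ (waveB C _ (norm_exp_I_mul θ).le f) = fourier0 θ f := by
  rw [distortedFourier_apply, comp_waveB C (norm_exp_I_mul θ)]

theorem distortedFourier_surjective (C : Coin) (θ : ℝ) :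
    Function.Surjective (distortedFourier C θ) := fun φ => by
  obtain ⟨f, hf⟩ := fourier0_surjective θ φ
  exact ⟨_, (distortedFourier_waveB C θ f).trans hf⟩

theorem evol_adjoint_distortedFourier (C : Coin) (θ : ℝ) (φ : SpaceH) :
    evol C (adjoint (distortedFourier C θ) φ).seq =
      Complex.exp (Complex.I * θ) • (adjoint (distortedFourier C θ) φ).seq := by
  rw [evol_eq_iff C (norm_exp_I_mul θ) _ _ (adjointFunctional_delta (distortedFourier C θ) φ)]
  intro i
  rw [← waveB_shiftDelta C (norm_exp_I_mul θ).le]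
  change inner ℂ φ (distortedFourier C θ _) = 0
  rw [distortedFourier_waveB, fourier0_shiftDelta, inner_zero_right]

theorem exists_adjoint_distortedFourier_eq (C : Coin) (θ : ℝ) (u : SpaceBs)
    (hu : evol C u.seq = Complex.exp (Complex.I * θ) • u.seq) :
    ∃ φ, adjoint (distortedFourier C θ) φ = u := by
  rw [evol_eq_iff C (norm_exp_I_mul θ) _ _ (dual_delta u)] at hu
  -- Composing the functional of u with W converts vanishing on (U - l) δ into vanishing on (S - l)
  -- δ, where the free representation applies.
  obtain ⟨φ, hφ⟩ := exists_adjointFunctional_eq θ (dual u ∘L waveB C _ (norm_exp_I_mul θ).le)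
    fun i => by
      rw [ContinuousLinearMap.comp_apply, waveB_shiftDelta]; exact hu i
  refine ⟨φ, SpaceBs.ext (funext fun i => (starRingEnd ℂ).injective ?_)⟩
  rw [← adjointFunctional_delta, ← dual_delta]
  -- Evaluating at W⁻¹ δ undoes the composition with W and turns 𝓕⁽⁰⁾ into 𝓕⁽⁺⁾.
  have h := hφ ((ContinuousLinearMap.id ℂ SpaceB - pertRes C _ (norm_exp_I_mul θ).le) (delta i))
  rw [ContinuousLinearMap.comp_apply, waveB_comp C (norm_exp_I_mul θ)] at h
  rw [← h]
  change inner ℂ φ (distortedFourier C θ (delta i)) = _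
  rw [distortedFourier_apply]
  rfl

end QuantumWalk

end

theorem theorem4 (C : QuantumWalk.Coin) (θ : ℝ) (hθ : θ ∈ Set.Ico 0 (2 * Real.pi)) :
    QuantumWalk.IsBoundaryResolvent C θ (QuantumWalk.boundaryResolvent C θ) ∧
    Set.range (QuantumWalk.distortedFourier C θ) = Set.univ ∧
    {u : QuantumWalk.SpaceBs |
        QuantumWalk.evol C u.seq = Complex.exp (Complex.I * θ) • u.seq} =
      Set.range (QuantumWalk.adjoint (QuantumWalk.distortedFourier C θ)) := by
  refine ⟨QuantumWalk.isBoundaryResolvent_boundaryResolvent C θ,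
    (QuantumWalk.distortedFourier_surjective C θ).range_eq, Set.ext fun u => ⟨fun hu => ?_, ?_⟩⟩
  · exact QuantumWalk.exists_adjoint_distortedFourier_eq C θ u hu
  · rintro ⟨φ, rfl⟩
    exact QuantumWalk.evol_adjoint_distortedFourier C θ φ
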